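/- **Setting.** A *Puiseux principal part* is a finite sum $q=\sum_k a_k x^k$ with $a_k\in\mathbb{C}$ and exponents $k\in\mathbb{Q}_{>0}$. Its *slope* is the largest exponent present in it ($0$ if $q=0$), and its ramification order $\mathrm{ram}(q)$ is the least common multiple of the denominators of the exponents present. The Galois action is generated by $\sigma(x^k)=e^{-2\pi i k}x^k$; the orbit of $q$ is denoted $\langle q\rangle$. Write $\tau_k(q)$ for the truncation of $q$ discarding all monomials of exponent $<k$. A *pointed irregular type* is a list $Q=[(n_1,q_1),\dots,(n_m,q_m)]$ with integers $n_i\ge 1$ and Puiseux principal parts $q_i$ in pairwise distinct Galois orbits. For a list $Q'=[(n'_1,q'_1),\dots,(n'_m,q'_m)]$ of the same length write $Q'\sim Q$ if $n'_i=n_i$ for all $i$ and $\mathrm{slope}(\sigma^k q'_i-\sigma^l q'_j)=\mathrm{slope}(\sigma^k q_i-\sigma^l q_j)$ for all $i,j$ and all $0\le k\le\mathrm{ram}(q_i)$, $0\le l\le\mathrm{ram}(q_j)$. Let $r=\mathrm{lcm}_i\,\mathrm{ram}(q_i)$, let $K=\max_i\mathrm{slope}(q_i)$ be the Poincaré–Katz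 rank, and $s=rK\in\mathbb{N}$. The *configuration space* $\mathbf{B}(Q)\subset\mathbb{C}^{ms}$, with the subspace topology, is the set of $(a_{ij})$ such that $[(n_i,\sum_{j=1}^s a_{ij}x^{j/r})]_{i=1}^m\sim Q$. **Fission tree.** Let $L_i$ be the set of nonzero slopes of differences of two Galois conjugates of $q_i$ (the levels), and for a finite set of levels $L=\{k_1>\dots>k_p\}$ let $A(L)=\mathbb{N}_{>0}\cup\bigcup_{j}\big((0,k_j]\cap\tfrac1{r_j}\mathbb{N}\big)$, where $r_j$ is the lcm of the denominators of $k_1,\dots,k_j$. Put $A_i=A(L_i)$, $A=\bigcup_i A_i$. For two indices $i,j$ let $k$ be the smallest exponent of $q_i$ with $\langle\tau_k(q_i)\rangle=\langle\tau_k(q_j)\rangle$; the fission exponent $f_{ij}$ is the larger of the slopes of $q_i-\tau_k(q_i)$ and $q_j-\tau_k(q_j)$ (of $q_i$ and $q_j$, if there is no such $k$). The *fission tree* $\mathcal{T}$ of $Q$ is obtained from $m$ copies of $\mathbb{R}_{\ge0}$ (full branches, with height map $h$ to $\mathbb{R}_{\ge 0}$) by gluing the $i$th and the $j$th over $[g_{ij},\infty)$,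 where $g_{ij}$ is the smallest element of $A$ that is $>f_{ij}$. Its vertices are $\mathbb{V}=h^{-1}(A\cup\{0\})$; the *admissible* (nonempty) vertices $\mathbb{A}$ are the images of the sets $A_i$, the *mandatory* vertices $\mathbb{L}\subset\mathbb{A}$ are the images of the sets $L_i$, and the vertices in $\mathbb{A}\setminus\mathbb{L}$ are called *inconsequential*. The ramification index $\mathrm{Ram}(v)$ is the lcm of the denominators of the heights of the mandatory vertices that equal $v$ or are ancestors of $v$ (larger height, on a common full branch). The vertex set $\mathbb{V}^\flat$ of the truncated fission tree $\mathcal{T}^\flat$ consists of the vertices of height at most $\lfloor K+1\rfloor$. For a vertex $v$ with set of admissible children $\mathrm{Ch}_{\mathbb{A}}(v)$, let $\mathbf{B}_v$ be the space of maps $c:\mathrm{Ch}_{\mathbb{A}}(v)\to\mathbb{C}$ such that $c(u)\ne0$ for all mandatory $u$ and $c(u)^N\ne c(w)^N$ for all $u\ne w$, where $N$ is the relative ramification $\mathrm{Ram}(u)/\mathrm{Ram}(v)$ (the same for all $u\in\mathrm{Ch}_{\mathbb{A}}(v)$). **Theorem.** Let $Q$ be a pointed irregular type with fission tree $\mathcal{T}$.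 Then: 1. There is a homeomorphism $\mathbf{B}(Q)\cong\prod_{v\in\mathbb{V}^\flat}\mathbf{B}_v$. 2. For each $v\in\mathbb{V}^\flat$, if $v$ has no admissible child, $\mathbf{B}_v$ is a point; otherwise $v$ has a finite number $n\ge1$ of admissible children, and either they are all inconsequential and $\mathbf{B}_v$ is homeomorphic to $X_n=\{a\in\mathbb{C}^n : a_i\ne a_j\text{ for }i\ne j\}$, or they are all mandatory and $\mathbf{B}_v$ is homeomorphic to $X^*_{n,N}=\{a\in\mathbb{C}^n : a_i\ne0,\ a_i^N\ne a_j^N\text{ for }i\ne j\}$, where $N\ge1$ is the relative ramification, $\mathrm{Ram}(u)=N\,\mathrm{Ram}(v)$ for every admissible child $u$ of $v$. 3. The number $d$ of admissible vertices of $\mathcal{T}$ of height $\le K$ is finite, and $\mathbf{B}(Q)$ is a nonempty complex submanifold of $\mathbb{C}^{ms}$ of dimension $d$. 4. $\mathbf{B}(Q)$ is connected. -/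

import Mathlib

open scoped NNReal

namespace Fission

/-! ### Exponential factors -/

/-- Puiseux principal parts `q = ∑ aₖ xᵏ`: finite sums with complex coefficients and positive
rational exponents. -/
abbrev PuiseuxPart : Type := {k : ℚ≥0 // 0 < k} →₀ ℂ

/-- The slope of `q`: the largest exponent present in `q` (and `0` if `q = 0`). -/
noncomputable def slope (q : PuiseuxPart) : ℚ≥0 := q.support.sup fun k => (k : ℚ≥0)

/-- The ramification order of `q`: the least common multiple of the denominators of the
exponents present in `q`. -/
noncomputable def ram (q : PuiseuxPart) : ℕ := q.support.lcm fun k => (k : ℚ≥0).den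

/-- The generator `σ` of the Galois action, `σ(xᵏ) = exp(-2πik) xᵏ`. -/
noncomputable def galois (q : PuiseuxPart) : PuiseuxPart :=
  Finsupp.onFinset q.support
    (fun k => Complex.exp (-(2 * Real.pi * Complex.I * ((k : ℚ≥0) : ℂ))) * q k)
    (by
      intro k hk
      rw [Finsupp.mem_support_iff]
      exact right_ne_zero_of_mul hk)

/-- `⟨p⟩ = ⟨q⟩`: the two principal parts lie in the same Galois orbit, i.e. define the same
Stokes circle. -/
def SameCircle (p q : PuiseuxPart) : Prop := ∃ i : ℕ, galois^[i] p = q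

open Classical in
/-- The truncation `τₖ`, discarding all monomials of slope `< k`. -/
noncomputable def trunc (k : ℚ≥0) (q : PuiseuxPart) : PuiseuxPart :=
  q.filter fun l => k ≤ (l : ℚ≥0)

/-- The levels of the Stokes circle `⟨q⟩`: the non-zero slopes of differences of two Galois
conjugates of `q`. -/
def levels (q : PuiseuxPart) : Set ℚ≥0 :=
  {k | 0 < k ∧ ∃ a b : ℕ, slope (galois^[a] q - galois^[b] q) = k}

/-- The exponent `l` belongs to the range of the common part of `p` and `q`, i.e. `l ≥ k` where `k`
is the smallest exponent occurring in `p` such that `⟨τₖ p⟩ = ⟨τₖ q⟩` (no `l` does, if there is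
no such `k`). -/
def InCommonRange (p q : PuiseuxPart) (l : ℚ≥0) : Prop :=
  ∃ k ∈ p.support, (k : ℚ≥0) ≤ l ∧ SameCircle (trunc k p) (trunc k q)

open Classical in
/-- The fission exponent of `p` and `q`: the larger of the slopes of the two different parts
`p - p_c` and `q - q_c`, with `p_c`, `q_c` the common parts. -/
noncomputable def fissionExponent (p q : PuiseuxPart) : ℚ≥0 :=
  max (slope (p.filter fun l => ¬ InCommonRange p q l))
    (slope (q.filter fun l => ¬ InCommonRange p q l))

/-! ### Pointed irregular types and their configuration spaces -/

/-- `Q = [(n₁, q₁), …, (nₘ, qₘ)]` is a pointed irregular type: the multiplicities are positive,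
and the `qᵢ` lie in distinct Galois orbits. -/
structure IsPointedIrregularType {m : ℕ} (Q : Fin m → ℕ × PuiseuxPart) : Prop where
  mult_pos : ∀ i, 0 < (Q i).1
  distinct : ∀ i j, i ≠ j → ¬ SameCircle (Q i).2 (Q j).2

/-- Numerical equivalence `Q' ∼ Q` of two lists of the same length. -/
def NumEquiv {m : ℕ} (Q' Q : Fin m → ℕ × PuiseuxPart) : Prop :=
  (∀ i, (Q' i).1 = (Q i).1) ∧
    ∀ i j : Fin m, ∀ k l : ℕ, k ≤ ram (Q i).2 → l ≤ ram (Q j).2 →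
      slope (galois^[k] (Q' i).2 - galois^[l] (Q' j).2) =
        slope (galois^[k] (Q i).2 - galois^[l] (Q j).2)

/-- The total ramification `r` of `Q`. -/
noncomputable def totalRam {m : ℕ} (Q : Fin m → ℕ × PuiseuxPart) : ℕ :=
  Finset.univ.lcm fun i => ram (Q i).2

/-- The Poincaré–Katz rank `K` of `Q`: the largest slope. -/
noncomputable def katz {m : ℕ} (Q : Fin m → ℕ × PuiseuxPart) : ℚ≥0 :=
  Finset.univ.sup fun i => slope (Q i).2

/-- The integer `s = r K`. -/
noncomputable def numCoeffs {m : ℕ} (Q : Fin m → ℕ × PuiseuxPart) : ℕ :=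
  ⌊(totalRam Q : ℚ≥0) * katz Q⌋₊

theorem ram_pos (q : PuiseuxPart) : 0 < ram q := by
  rw [Nat.pos_iff_ne_zero, ram, Ne, Finset.lcm_eq_zero_iff]
  rintro ⟨k, -, hk⟩
  exact NNRat.den_ne_zero _ hk

theorem totalRam_pos {m : ℕ} (Q : Fin m → ℕ × PuiseuxPart) : 0 < totalRam Q := by
  rw [Nat.pos_iff_ne_zero, totalRam, Ne, Finset.lcm_eq_zero_iff]
  rintro ⟨i, -, hi⟩
  exact (ram_pos _).ne' hi

/-- The exponent `(j + 1) / r` of the monomial `t ^ (j + 1)`, where `t = x ^ (1 / r)`. -/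
noncomputable def monomialExponent {m : ℕ} (Q : Fin m → ℕ × PuiseuxPart) (j : ℕ) :
    {k : ℚ≥0 // 0 < k} :=
  ⟨((j : ℚ≥0) + 1) / (totalRam Q : ℚ≥0),
    div_pos (by positivity) (Nat.cast_pos.mpr (totalRam_pos Q))⟩

/-- The list `Q_a = [(n₁, ∑ⱼ a₁ⱼ tʲ), …, (nₘ, ∑ⱼ aₘⱼ tʲ)]` with `t = x ^ (1 / r)`; the powers
`t¹, …, tˢ` are indexed by `j = 0, …, s - 1`. -/
noncomputable def ofCoeffs {m : ℕ} (Q : Fin m → ℕ × PuiseuxPart)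
    (a : Fin m → Fin (numCoeffs Q) → ℂ) : Fin m → ℕ × PuiseuxPart :=
  fun i => ((Q i).1, ∑ j : Fin (numCoeffs Q), Finsupp.single (monomialExponent Q j) (a i j))

/-- The configuration space `𝐁(Q)`, a subspace of `ℂ^(m s)`. -/
def configSpace {m : ℕ} (Q : Fin m → ℕ × PuiseuxPart) :
    Set (Fin m → Fin (numCoeffs Q) → ℂ) :=
  {a | NumEquiv (ofCoeffs Q a) Q}

/-! ### Admissible exponents -/

/-- The ramification index at `k` of a set of levels `L`: the least common multiple of the
denominators of the levels `≥ k`. -/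
noncomputable def ramIndexAt (L : Set ℚ≥0) (k : ℚ≥0) : ℕ :=
  sInf {d : ℕ | 0 < d ∧ ∀ l ∈ L, k ≤ l → l.den ∣ d}

/-- The admissible exponents
`A(L) = ℕ_{>0} ∪ ((0, k₁] ∩ (1/r₁)ℕ) ∪ ⋯ ∪ ((0, kₘ] ∩ (1/rₘ)ℕ)` of the set of levels
`L = {k₁ > ⋯ > kₘ}`, where `rᵢ` is the least common multiple of the denominators of
`k₁, …, kᵢ`. -/
def admissibleExponents (L : Set ℚ≥0) : Set ℚ≥0 :=
  {a | 0 < a ∧ ((∃ n : ℕ, a = n) ∨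
    ∃ k ∈ L, a ≤ k ∧ ∃ n : ℕ, a = (n : ℚ≥0) / (ramIndexAt L k : ℚ≥0))}

/-! ### Fission trees -/

/-- A list of `m` level sets with multiplicities, together with fission exponents. -/
structure FissionDatum (m : ℕ) where
  mult : Fin m → ℕ
  level : Fin m → Set ℚ≥0
  exponent : Fin m → Fin m → ℚ≥0

/-- The labelled fission datum of `Q`. -/
noncomputable def fissionDatum {m : ℕ} (Q : Fin m → ℕ × PuiseuxPart) : FissionDatum m where
  mult i := (Q i).1
  level i := levels (Q i).2
  exponent i j := fissionExponent (Q i).2 (Q j).2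

namespace FissionDatum

variable {m : ℕ} (D : FissionDatum m)

/-- The union `A` of the admissible exponents of all the branches. -/
def exponents : Set ℚ≥0 := {a | ∃ i, a ∈ admissibleExponents (D.level i)}

/-- The gluing of the full branches `ℬᵢ = ℝ≥0`, `i = 1, …, m`: the branches `i` and `j` are
identified over `[gᵢⱼ, ∞)`, where the gluing exponent `gᵢⱼ` is the smallest element of `A` that is
greater than the fission exponent `fᵢⱼ`. -/
def Glue (p q : Fin m × ℝ≥0) : Prop :=
  p.2 = q.2 ∧
    ∃ g : ℚ≥0, IsLeast {a ∈ D.exponents | D.exponent p.1 q.1 < a} g ∧ (g : ℝ≥0) ≤ p.2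

/-- (The points of) the fission tree `𝒯`. -/
def Tree : Type := Quot D.Glue

/-- The point of height `t` on the full branch of the leaf `i`. -/
def point (i : Fin m) (t : ℝ≥0) : D.Tree := Quot.mk D.Glue (i, t)

/-- The height map `h : 𝒯 → ℝ≥0`. -/
def height : D.Tree → ℝ≥0 := Quot.lift Prod.snd fun _ _ h => h.1

/-- The vertices `𝕍 = h⁻¹(A ∪ {0})`. -/
def vertices : Set D.Tree :=
  {v | D.height v = 0 ∨ ∃ a ∈ D.exponents, D.height v = (a : ℝ≥0)}

/-- The admissible (non-empty) vertices `𝔸`. -/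
def admissibleVertices : Set D.Tree :=
  {v | ∃ i, ∃ a ∈ admissibleExponents (D.level i), v = D.point i (a : ℝ≥0)}

/-- The mandatory vertices (internal levels) `𝕃`. -/
def mandatoryVertices : Set D.Tree :=
  {v | ∃ i, ∃ k ∈ D.level i, v = D.point i (k : ℝ≥0)}

/-- The inconsequential vertices `𝕀 = 𝔸 ∖ 𝕃`. -/
def inconsequentialVertices : Set D.Tree := D.admissibleVertices \ D.mandatoryVertices

/-- `u` is an ancestor of `v` (or equal to it): both lie on a common full branch, and `u` is not
below `v`. -/
def IsAncestor (u v : D.Tree) : Prop :=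
  ∃ i, ∃ s t : ℝ≥0, s ≤ t ∧ v = D.point i s ∧ u = D.point i t

/-- The vertex `w` is a child of the vertex `v`. -/
def IsChild (w v : D.Tree) : Prop :=
  w ∈ D.vertices ∧ v ∈ D.vertices ∧ w ≠ v ∧ D.IsAncestor v w ∧
    ∀ u ∈ D.vertices, D.IsAncestor u w → D.IsAncestor v u → u = w ∨ u = v

/-- The set `Ch_𝔸(v)` of admissible children of `v`. -/
def admissibleChildren (v : D.Tree) : Set D.Tree := {w | D.IsChild w v ∧ w ∈ D.admissibleVertices}

/-- The ramification index of a point `v` of the tree: the least common multiple of the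
denominators of the heights of the mandatory ancestors of `v` (including `v` itself). -/
noncomputable def ramIndex (v : D.Tree) : ℕ :=
  sInf {d : ℕ | 0 < d ∧
    ∀ i, ∀ k ∈ D.level i, D.IsAncestor (D.point i (k : ℝ≥0)) v → k.den ∣ d}

/-- The relative ramification `N = Ram(u) / Ram(v)` of the parent `v` of `u`. (It is the same for
all admissible children `u` of `v`.) -/
noncomputable def relRam (v u : D.Tree) : ℕ := D.ramIndex u / D.ramIndex v

/-- The local configuration space `𝐁ᵥ(𝒯)`. -/
def localConfig (v : D.Tree) : Set (D.admissibleChildren v → ℂ) :=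
  {c | (∀ u : D.admissibleChildren v, (u : D.Tree) ∈ D.mandatoryVertices → c u ≠ 0) ∧
    ∀ u w : D.admissibleChildren v, u ≠ w → c u ^ D.relRam v u ≠ c w ^ D.relRam v u}

end FissionDatum

/-- The vertices `𝕍♭` of the truncated fission tree of `Q`: those of height at most
`η = ⌊K + 1⌋`, the height of the root. -/
def truncatedVertices {m : ℕ} (Q : Fin m → ℕ × PuiseuxPart) : Set (fissionDatum Q).Tree :=
  {v ∈ (fissionDatum Q).vertices | (fissionDatum Q).height v ≤ (⌊katz Q + 1⌋₊ : ℝ≥0)}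

/-- The admissible vertices of height at most the Poincaré–Katz rank. -/
def boundedAdmissibleVertices {m : ℕ} (Q : Fin m → ℕ × PuiseuxPart) :
    Set (fissionDatum Q).Tree :=
  {v ∈ (fissionDatum Q).admissibleVertices | (fissionDatum Q).height v ≤ (katz Q : ℝ≥0)}

/-! ### Model spaces and dimension -/

/-- `X_n`, the configurations of `n` distinct complex numbers. -/
def configX (n : ℕ) : Set (Fin n → ℂ) := {a | ∀ i j, i ≠ j → a i ≠ a j}

/-- `X*_{n,N}`, the configurations of `n` nonzero complex numbers with distinct `N`-th powers. -/
def configXStar (n N : ℕ) : Set (Fin n → ℂ) :=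
  {a | (∀ i, a i ≠ 0) ∧ ∀ i j, i ≠ j → a i ^ N ≠ a j ^ N}

/-- The subset `S` of the finite-dimensional complex vector space `E` is a nonempty complex
submanifold of dimension `d`: near each of its points it is the zero set of a holomorphic
submersion to `ℂ^c`, where `c + d = dim E`. -/
def HasComplexDim {E : Type*} [NormedAddCommGroup E] [NormedSpace ℂ E] [FiniteDimensional ℂ E]
    (S : Set E) (d : ℕ) : Prop :=
  S.Nonempty ∧ ∀ p ∈ S, ∃ U : Set E, IsOpen U ∧ p ∈ U ∧
    ∃ (c : ℕ) (f : E → Fin c → ℂ), c + d = Module.finrank ℂ E ∧ DifferentiableOn ℂ f U ∧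
      (∀ x ∈ U, Function.Surjective (fderiv ℂ f x)) ∧ S ∩ U = {x ∈ U | f x = 0}

end Fission

open Fission

namespace Fission

/-! ### The Galois action in coordinates -/

/-- Positive rational exponents. -/
abbrev Expo : Type := {k : ℚ≥0 // 0 < k}

/-- The factor by which `σ` multiplies `xᵏ`. -/
noncomputable def chi (k : Expo) : ℂ := Complex.exp (-(2 * Real.pi * Complex.I * ((k : ℚ≥0) : ℂ)))

theorem chi_ne_zero (k : Expo) : chi k ≠ 0 := Complex.exp_ne_zero _

theorem den_dvd_iff (a : ℚ≥0) (d : ℕ) : a.den ∣ d ↔ ∃ n : ℕ, a * d = n := by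
  constructor
  · rintro ⟨e, rfl⟩
    exact ⟨a.num * e, by push_cast; rw [← mul_assoc, NNRat.mul_den_eq_num]⟩
  · rintro ⟨n, hn⟩
    have h : a.num * d = n * a.den := by
      have : (a.num : ℚ≥0) * d = n * a.den := by
        rw [← hn, ← NNRat.mul_den_eq_num]; ring
      exact_mod_cast this
    exact (NNRat.coprime_num_den a).symm.dvd_of_dvd_mul_left (h ▸ dvd_mul_left _ _)

theorem isPrimitiveRoot_chi (k : Expo) : IsPrimitiveRoot (chi k) (k : ℚ≥0).den := by
  have h := (Complex.isPrimitiveRoot_exp_of_coprime (k : ℚ≥0).num (k : ℚ≥0).den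
    (NNRat.den_ne_zero _) (NNRat.coprime_num_den _)).inv
  rw [← Complex.exp_neg] at h
  have h2 : (((k : ℚ≥0).num : ℂ) / ((k : ℚ≥0).den : ℂ)) = (((k : ℚ≥0) : ℚ≥0) : ℂ) :=
    (NNRat.cast_def _).symm
  rwa [h2] at h

theorem chi_zpow_eq_one_iff (k : Expo) (n : ℤ) :
    chi k ^ n = 1 ↔ (((k : ℚ≥0).den : ℕ) : ℤ) ∣ n :=
  (isPrimitiveRoot_chi k).zpow_eq_one_iff_dvd n

/-- The action of `σⁿ`, for `n` an integer. -/
noncomputable def gal (n : ℤ) (q : PuiseuxPart) : PuiseuxPart :=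
  Finsupp.onFinset q.support (fun k => chi k ^ n * q k) (by
    intro k hk
    rw [Finsupp.mem_support_iff]
    exact right_ne_zero_of_mul hk)

theorem gal_apply (n : ℤ) (q : PuiseuxPart) (k : Expo) : gal n q k = chi k ^ n * q k := rfl

theorem gal_gal (a b : ℤ) (q : PuiseuxPart) : gal a (gal b q) = gal (a + b) q := by
  ext k
  rw [gal_apply, gal_apply, gal_apply, zpow_add₀ (chi_ne_zero k), mul_assoc]

theorem gal_zero (q : PuiseuxPart) : gal 0 q = q := by
  ext k
  simp [gal_apply]

theorem galois_iterate (n : ℕ) (q : PuiseuxPart) : galois^[n] q = gal n q := by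
  induction n with
  | zero => simp [gal_zero]
  | succ n ih =>
    rw [Function.iterate_succ_apply', ih]
    have : galois (gal n q) = gal 1 (gal n q) := by
      ext k
      rw [gal_apply, zpow_one]
      rfl
    rw [this, gal_gal, add_comm]
    simp

theorem gal_ne_zero_iff (n : ℤ) (q : PuiseuxPart) (k : Expo) : gal n q k ≠ 0 ↔ q k ≠ 0 := by
  rw [gal_apply, mul_ne_zero_iff]
  exact ⟨fun h => h.2, fun h => ⟨zpow_ne_zero _ (chi_ne_zero k), h⟩⟩

theorem gal_support (n : ℤ) (q : PuiseuxPart) : (gal n q).support = q.support := by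
  ext k
  simp only [Finsupp.mem_support_iff]
  exact gal_ne_zero_iff n q k

theorem gal_apply_eq_iff (a b : ℤ) (p q : PuiseuxPart) (k : Expo) :
    gal a p k = gal b q k ↔ p k = gal (b - a) q k := by
  have h := zpow_ne_zero a (chi_ne_zero k)
  rw [gal_apply, gal_apply, gal_apply, sub_eq_neg_add, zpow_add₀ (chi_ne_zero k), zpow_neg]
  constructor
  · intro e
    rw [mul_assoc, ← e, inv_mul_cancel_left₀ h]
  · intro e
    rw [e, mul_assoc, mul_inv_cancel_left₀ h]

theorem gal_apply_self_iff (n : ℤ) (q : PuiseuxPart) (k : Expo) :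
    q k = gal n q k ↔ q k ≠ 0 → (((k : ℚ≥0).den : ℕ) : ℤ) ∣ n := by
  rw [gal_apply, ← chi_zpow_eq_one_iff]
  by_cases h : q k = 0
  · simp [h]
  · simp only [ne_eq, h, not_false_eq_true, forall_const]
    rw [eq_comm]
    exact mul_eq_right₀ h

/-! ### Agreement down to an exponent -/

/-- The coefficients of `p` and `q` coincide at all the exponents `≥ t`. -/
def Agree (t : Expo) (p q : PuiseuxPart) : Prop := ∀ k : Expo, t ≤ k → p k = q k

/-- The coefficients of `p` and `q` coincide at all the exponents `> t`. -/
def AgreeAbove (t : Expo) (p q : PuiseuxPart) : Prop := ∀ k : Expo, t < k → p k = q k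

namespace Agree

theorem refl (t : Expo) (p : PuiseuxPart) : Agree t p p := fun _ _ => rfl

theorem symm {t : Expo} {p q : PuiseuxPart} (h : Agree t p q) : Agree t q p :=
  fun k hk => (h k hk).symm

theorem trans {t : Expo} {p q u : PuiseuxPart} (h : Agree t p q) (h' : Agree t q u) :
    Agree t p u := fun k hk => (h k hk).trans (h' k hk)

theorem mono {t s : Expo} {p q : PuiseuxPart} (h : Agree t p q) (hs : t ≤ s) : Agree s p q :=
  fun k hk => h k (hs.trans hk)

theorem above {t : Expo} {p q : PuiseuxPart} (h : Agree t p q) : AgreeAbove t p q :=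
  fun k hk => h k hk.le

end Agree

theorem agree_iff_above {t : Expo} {p q : PuiseuxPart} :
    Agree t p q ↔ AgreeAbove t p q ∧ p t = q t := by
  refine ⟨fun h => ⟨h.above, h t le_rfl⟩, fun h k hk => ?_⟩
  rcases hk.eq_or_lt with rfl | hk
  · exact h.2
  · exact h.1 k hk

theorem agreeAbove_iff {t : Expo} {p q : PuiseuxPart} :
    AgreeAbove t p q ↔ ∀ s, t < s → Agree s p q :=
  ⟨fun h _ hs k hk => h k (hs.trans_le hk), fun h k hk => h k hk k le_rfl⟩

theorem agree_gal_iff (t : Expo) (a b : ℤ) (p q : PuiseuxPart) :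
    Agree t (gal a p) (gal b q) ↔ Agree t p (gal (b - a) q) :=
  forall₂_congr fun k _ => gal_apply_eq_iff a b p q k

theorem Agree.gal {t : Expo} {p q : PuiseuxPart} (h : Agree t p q) (n : ℤ) :
    Agree t (gal n p) (gal n q) := by
  rw [agree_gal_iff, sub_self, gal_zero]
  exact h

theorem slope_lt_iff (q : PuiseuxPart) (t : Expo) :
    slope q < t ↔ ∀ k : Expo, t ≤ k → q k = 0 := by
  rw [slope, Finset.sup_lt_iff (show (⊥ : ℚ≥0) < t from t.2)]
  constructor
  · intro h k hk
    by_contra h0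
    exact absurd (h k (Finsupp.mem_support_iff.2 h0)) (not_lt.2 hk)
  · intro h k hk
    by_contra h0
    exact Finsupp.mem_support_iff.1 hk (h k (not_lt.1 h0))

theorem slope_sub_lt_iff (p q : PuiseuxPart) (t : Expo) : slope (p - q) < t ↔ Agree t p q := by
  rw [slope_lt_iff]
  exact forall₂_congr fun k _ => by rw [Finsupp.sub_apply, sub_eq_zero]

theorem eq_iff_forall_lt_iff (x y : ℚ≥0) : x = y ↔ ∀ t : Expo, x < t ↔ y < t := by
  refine ⟨fun h t => by rw [h], fun h => ?_⟩
  rcases lt_trichotomy x y with hxy | hxy | hxy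
  · exact absurd ((h ⟨y, (zero_le).trans_lt hxy⟩).1 hxy) (lt_irrefl _)
  · exact hxy
  · exact absurd ((h ⟨x, (zero_le).trans_lt hxy⟩).2 hxy) (lt_irrefl _)

theorem apply_slope_ne_zero (q : PuiseuxPart) (h : 0 < slope q) : q ⟨slope q, h⟩ ≠ 0 := by
  intro h0
  have hlt : slope q < ((⟨slope q, h⟩ : Expo) : ℚ≥0) → False := lt_irrefl _
  apply hlt
  have hne : q.support.Nonempty := by
    rw [Finset.nonempty_iff_ne_empty]
    intro he
    simp [slope, he] at h
  obtain ⟨k, hk, hk'⟩ := Finset.exists_mem_eq_sup _ hne fun k : Expo => (k : ℚ≥0)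
  have : (⟨slope q, h⟩ : Expo) = k := Subtype.ext hk'
  rw [this] at h0
  exact absurd h0 (Finsupp.mem_support_iff.1 hk)

/-! ### Ramification indices -/

/-- The least common multiple of the denominators of the exponents `≥ t` of `q`. -/
noncomputable def denLcm (q : PuiseuxPart) (t : Expo) : ℕ :=
  (q.support.filter fun k => t ≤ k).lcm fun k => (k : ℚ≥0).den

/-- The least common multiple of the denominators of the exponents `> t` of `q`. -/
noncomputable def denLcmAbove (q : PuiseuxPart) (t : Expo) : ℕ :=
  (q.support.filter fun k => t < k).lcm fun k => (k : ℚ≥0).den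

theorem denLcm_dvd_iff {q : PuiseuxPart} {t : Expo} {d : ℕ} :
    denLcm q t ∣ d ↔ ∀ k : Expo, t ≤ k → q k ≠ 0 → (k : ℚ≥0).den ∣ d := by
  rw [denLcm, Finset.lcm_dvd_iff]
  simp only [Finset.mem_filter, Finsupp.mem_support_iff]
  exact ⟨fun h k h1 h2 => h k ⟨h2, h1⟩, fun h k h1 => h k h1.2 h1.1⟩

theorem denLcmAbove_dvd_iff {q : PuiseuxPart} {t : Expo} {d : ℕ} :
    denLcmAbove q t ∣ d ↔ ∀ k : Expo, t < k → q k ≠ 0 → (k : ℚ≥0).den ∣ d := by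
  rw [denLcmAbove, Finset.lcm_dvd_iff]
  simp only [Finset.mem_filter, Finsupp.mem_support_iff]
  exact ⟨fun h k h1 h2 => h k ⟨h2, h1⟩, fun h k h1 => h k h1.2 h1.1⟩

theorem denLcm_pos (q : PuiseuxPart) (t : Expo) : 0 < denLcm q t := by
  rw [Nat.pos_iff_ne_zero, denLcm, Ne, Finset.lcm_eq_zero_iff]
  rintro ⟨k, -, hk⟩
  exact NNRat.den_ne_zero _ hk

theorem denLcmAbove_pos (q : PuiseuxPart) (t : Expo) : 0 < denLcmAbove q t := by
  rw [Nat.pos_iff_ne_zero, denLcmAbove, Ne, Finset.lcm_eq_zero_iff]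
  rintro ⟨k, -, hk⟩
  exact NNRat.den_ne_zero _ hk

theorem den_dvd_denLcm {q : PuiseuxPart} {t k : Expo} (h : t ≤ k) (hk : q k ≠ 0) :
    (k : ℚ≥0).den ∣ denLcm q t := denLcm_dvd_iff.1 dvd_rfl k h hk

theorem den_dvd_denLcmAbove {q : PuiseuxPart} {t k : Expo} (h : t < k) (hk : q k ≠ 0) :
    (k : ℚ≥0).den ∣ denLcmAbove q t := denLcmAbove_dvd_iff.1 dvd_rfl k h hk

theorem denLcm_anti {q : PuiseuxPart} {s t : Expo} (h : s ≤ t) : denLcm q t ∣ denLcm q s :=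
  denLcm_dvd_iff.2 fun _ hk h0 => den_dvd_denLcm (h.trans hk) h0

theorem denLcmAbove_dvd_denLcm (q : PuiseuxPart) (t : Expo) : denLcmAbove q t ∣ denLcm q t :=
  denLcmAbove_dvd_iff.2 fun _ hk h0 => den_dvd_denLcm hk.le h0

theorem denLcm_dvd_ram (q : PuiseuxPart) (t : Expo) : denLcm q t ∣ ram q :=
  denLcm_dvd_iff.2 fun _ _ h0 => Finset.dvd_lcm (Finsupp.mem_support_iff.2 h0)

theorem denLcm_dvd_lcm (q : PuiseuxPart) (t : Expo) :
    denLcm q t ∣ Nat.lcm (denLcmAbove q t) (t : ℚ≥0).den :=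
  denLcm_dvd_iff.2 fun k hk h0 => by
    rcases hk.eq_or_lt with rfl | hk
    · exact Nat.dvd_lcm_right _ _
    · exact (den_dvd_denLcmAbove hk h0).trans (Nat.dvd_lcm_left _ _)

theorem denLcm_eq_lcm {q : PuiseuxPart} {t : Expo} (h : (t : ℚ≥0).den ∣ denLcm q t) :
    denLcm q t = Nat.lcm (denLcmAbove q t) (t : ℚ≥0).den :=
  Nat.dvd_antisymm (denLcm_dvd_lcm q t) (Nat.lcm_dvd (denLcmAbove_dvd_denLcm q t) h)

theorem denLcm_gal (n : ℤ) (q : PuiseuxPart) (t : Expo) : denLcm (gal n q) t = denLcm q t := by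
  rw [denLcm, denLcm, gal_support]

theorem denLcmAbove_gal (n : ℤ) (q : PuiseuxPart) (t : Expo) :
    denLcmAbove (gal n q) t = denLcmAbove q t := by
  rw [denLcmAbove, denLcmAbove, gal_support]

theorem Agree.denLcm_eq {t : Expo} {p q : PuiseuxPart} (h : Agree t p q) :
    denLcm p t = denLcm q t :=
  Nat.dvd_antisymm (denLcm_dvd_iff.2 fun k hk h0 => den_dvd_denLcm hk (h k hk ▸ h0))
    (denLcm_dvd_iff.2 fun k hk h0 => den_dvd_denLcm hk ((h k hk).symm ▸ h0))

theorem AgreeAbove.denLcmAbove_eq {t : Expo} {p q : PuiseuxPart} (h : AgreeAbove t p q) :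
    denLcmAbove p t = denLcmAbove q t :=
  Nat.dvd_antisymm
    (denLcmAbove_dvd_iff.2 fun k hk h0 => den_dvd_denLcmAbove hk (h k hk ▸ h0))
    (denLcmAbove_dvd_iff.2 fun k hk h0 => den_dvd_denLcmAbove hk ((h k hk).symm ▸ h0))

theorem agree_gal_self_iff (q : PuiseuxPart) (t : Expo) (n : ℤ) :
    Agree t q (gal n q) ↔ (denLcm q t : ℤ) ∣ n := by
  rw [Int.natCast_dvd, denLcm_dvd_iff]
  refine forall₂_congr fun k _ => ?_
  rw [gal_apply_self_iff, Int.natCast_dvd]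

theorem agreeAbove_gal_self_iff (q : PuiseuxPart) (t : Expo) (n : ℤ) :
    AgreeAbove t q (gal n q) ↔ (denLcmAbove q t : ℤ) ∣ n := by
  rw [Int.natCast_dvd, denLcmAbove_dvd_iff]
  refine forall₂_congr fun k _ => ?_
  rw [gal_apply_self_iff, Int.natCast_dvd]

theorem pow_eq_pow_iff_exists_chi (a : Expo) (R : ℕ) (hR : 0 < R) (z w : ℂ) :
    z ^ (Nat.lcm R (a : ℚ≥0).den / R) = w ^ (Nat.lcm R (a : ℚ≥0).den / R) ↔
      ∃ n : ℤ, (R : ℤ) ∣ n ∧ z = chi a ^ n * w := by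
  have hL : 0 < Nat.lcm R (a : ℚ≥0).den := Nat.lcm_pos hR (NNRat.den_pos _)
  have hN : 0 < Nat.lcm R (a : ℚ≥0).den / R :=
    Nat.div_pos (Nat.le_of_dvd hL (Nat.dvd_lcm_left _ _)) hR
  have hRN : R * (Nat.lcm R (a : ℚ≥0).den / R) = Nat.lcm R (a : ℚ≥0).den :=
    Nat.mul_div_cancel' (Nat.dvd_lcm_left _ _)
  set N := Nat.lcm R (a : ℚ≥0).den / R
  have hprim : IsPrimitiveRoot (chi a ^ R) N := by
    refine IsPrimitiveRoot.mk_of_lt _ hN ?_ ?_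
    · rw [← pow_mul, hRN]
      exact ((isPrimitiveRoot_chi a).pow_eq_one_iff_dvd _).2 (Nat.dvd_lcm_right _ _)
    · intro l hl hlN h1
      rw [← pow_mul, (isPrimitiveRoot_chi a).pow_eq_one_iff_dvd] at h1
      have h2 : R * N ∣ R * l := hRN ▸ Nat.lcm_dvd (dvd_mul_right _ _) h1
      exact absurd (Nat.le_of_dvd hl (Nat.dvd_of_mul_dvd_mul_left hR h2)) (not_le.2 hlN)
  constructor
  · intro h
    by_cases hw : w = 0
    · rw [hw, zero_pow hN.ne'] at h
      exact ⟨0, dvd_zero _, by rw [hw, mul_zero]; exact eq_zero_of_pow_eq_zero h⟩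
    · have : NeZero N := ⟨hN.ne'⟩
      have h1 : (z / w) ^ N = 1 := by rw [div_pow, h, div_self (pow_ne_zero _ hw)]
      obtain ⟨i, -, hi⟩ := hprim.eq_pow_of_pow_eq_one h1
      refine ⟨(R * i : ℕ), by push_cast; exact dvd_mul_right _ _, ?_⟩
      rw [zpow_natCast, pow_mul, hi, div_mul_cancel₀ _ hw]
  · rintro ⟨n, ⟨e, rfl⟩, rfl⟩
    rw [mul_pow, zpow_mul, zpow_natCast, ← zpow_natCast, ← zpow_mul, mul_comm e, zpow_mul,
      zpow_natCast, hprim.pow_eq_one, one_zpow, one_mul]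

/-! ### Levels and admissible exponents -/

theorem mem_levels_iff (q : PuiseuxPart) (k : Expo) :
    (k : ℚ≥0) ∈ levels q ↔ q k ≠ 0 ∧ ¬ (k : ℚ≥0).den ∣ denLcmAbove q k := by
  constructor
  · rintro ⟨hk, a, b, hab⟩
    rw [galois_iterate, galois_iterate] at hab
    have hab' : AgreeAbove k q (gal (b - a) q) := by
      rw [agreeAbove_iff]
      intro s hs
      rw [← agree_gal_iff, ← slope_sub_lt_iff, hab]
      exact hs
    have hnot : ¬ Agree k q (gal (b - a) q) := by
      rw [← agree_gal_iff, ← slope_sub_lt_iff, hab]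
      exact lt_irrefl _
    have hne : ¬ q k = gal (b - a) q k := fun h => hnot (agree_iff_above.2 ⟨hab', h⟩)
    rw [gal_apply_self_iff] at hne
    push Not at hne
    refine ⟨hne.1, fun h => hne.2 ?_⟩
    exact (Int.natCast_dvd_natCast.2 h).trans ((agreeAbove_gal_self_iff _ _ _).1 hab')
  · rintro ⟨h0, hd⟩
    refine ⟨k.2, 0, denLcmAbove q k, ?_⟩
    rw [galois_iterate, galois_iterate, eq_iff_forall_lt_iff]
    have hA : AgreeAbove k q (gal (denLcmAbove q k) q) := (agreeAbove_gal_self_iff _ _ _).2 dvd_rfl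
    intro t
    rw [slope_sub_lt_iff, agree_gal_iff, Nat.cast_zero, sub_zero]
    constructor
    · intro h
      by_contra hk
      have := (gal_apply_self_iff _ _ _).1 (h k (not_lt.1 hk)) h0
      exact hd (Int.natCast_dvd_natCast.1 this)
    · intro h
      exact agreeAbove_iff.1 hA t h

theorem forall_levels_dvd_iff (q : PuiseuxPart) (t : Expo) (d : ℕ) :
    (∀ l ∈ levels q, (t : ℚ≥0) ≤ l → l.den ∣ d) ↔ denLcm q t ∣ d := by
  constructor
  · intro h
    rw [← Int.natCast_dvd_natCast, ← agree_gal_self_iff, ← slope_sub_lt_iff]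
    by_contra hs
    rw [not_lt] at hs
    have hpos : 0 < slope (q - gal d q) := t.2.trans_le hs
    have h0 := apply_slope_ne_zero _ hpos
    set s : Expo := ⟨slope (q - gal d q), hpos⟩ with hsdef
    have hl : (s : ℚ≥0) ∈ levels q :=
      ⟨hpos, 0, d, by rw [galois_iterate, galois_iterate, Nat.cast_zero, gal_zero]⟩
    have hd := h s hl hs
    rw [Finsupp.sub_apply, sub_ne_zero] at h0
    exact h0 ((gal_apply_self_iff _ _ _).2 fun _ => Int.natCast_dvd_natCast.2 hd)
  · intro h l hl htl
    have := (mem_levels_iff q ⟨l, hl.1⟩).1 hl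
    exact (denLcm_dvd_iff.1 h) ⟨l, hl.1⟩ htl this.1

theorem sInf_multiples {R : ℕ} (hR : 0 < R) : sInf {d : ℕ | 0 < d ∧ R ∣ d} = R :=
  IsLeast.csInf_eq ⟨⟨hR, dvd_rfl⟩, fun _ hd => Nat.le_of_dvd hd.1 hd.2⟩

theorem ramIndexAt_levels (q : PuiseuxPart) (t : Expo) :
    ramIndexAt (levels q) t = denLcm q t := by
  rw [ramIndexAt]
  simp only [forall_levels_dvd_iff]
  exact sInf_multiples (denLcm_pos q t)

theorem mem_admissibleExponents_iff (q : PuiseuxPart) (a : Expo) :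
    (a : ℚ≥0) ∈ admissibleExponents (levels q) ↔ (a : ℚ≥0).den ∣ denLcm q a := by
  constructor
  · rintro ⟨-, ⟨n, hn⟩ | ⟨k, hk, hak, n, hn⟩⟩
    · rw [hn, NNRat.den_natCast]
      exact one_dvd _
    · have := ramIndexAt_levels q ⟨k, hk.1⟩
      simp only at this
      rw [this] at hn
      have h1 : (a : ℚ≥0).den ∣ denLcm q ⟨k, hk.1⟩ := by
        rw [den_dvd_iff]
        refine ⟨n, ?_⟩
        rw [hn, div_mul_cancel₀]
        exact_mod_cast (denLcm_pos q ⟨k, hk.1⟩).ne'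
      exact h1.trans (denLcm_anti (show a ≤ ⟨k, hk.1⟩ from hak))
  · intro h
    refine ⟨a.2, ?_⟩
    by_cases hd : (a : ℚ≥0).den = 1
    · left
      refine ⟨(a : ℚ≥0).num, ?_⟩
      rw [← NNRat.mul_den_eq_num, hd]
      simp
    · right
      have hlev : {l : Expo | (l : ℚ≥0) ∈ levels q ∧ a ≤ l}.Nonempty := by
        by_contra hne
        rw [Set.not_nonempty_iff_eq_empty] at hne
        have h1 : denLcm q a ∣ 1 := by
          rw [← forall_levels_dvd_iff]
          intro l hl hal
          have : (⟨l, hl.1⟩ : Expo) ∈ {l : Expo | (l : ℚ≥0) ∈ levels q ∧ a ≤ l} := ⟨hl, hal⟩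
          rw [hne] at this
          exact this.elim
        exact hd (Nat.dvd_one.1 (h.trans h1))
      have hfin : {l : Expo | (l : ℚ≥0) ∈ levels q ∧ a ≤ l}.Finite := by
        refine q.support.finite_toSet.subset fun l hl => ?_
        exact Finsupp.mem_support_iff.2 ((mem_levels_iff q l).1 hl.1).1
      obtain ⟨k, hk, hmin⟩ := hfin.exists_minimal hlev
      refine ⟨k, hk.1, hk.2, ?_⟩
      rw [ramIndexAt_levels]
      have h1 : denLcm q a ∣ denLcm q k := by
        rw [← forall_levels_dvd_iff]
        intro l hl hal
        have hl' : (⟨l, hl.1⟩ : Expo) ∈ {l : Expo | (l : ℚ≥0) ∈ levels q ∧ a ≤ l} := ⟨hl, hal⟩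
        have hkl : k ≤ ⟨l, hl.1⟩ := (le_total k ⟨l, hl.1⟩).elim id fun h => hmin hl' h
        exact den_dvd_denLcm hkl ((mem_levels_iff q ⟨l, hl.1⟩).1 hl).1
      obtain ⟨n, hn⟩ := (den_dvd_iff _ _).1 (h.trans h1)
      refine ⟨n, ?_⟩
      rw [← hn, mul_div_cancel_right₀]
      exact_mod_cast (denLcm_pos q k).ne'

theorem mem_levels_iff_of_admissible {q : PuiseuxPart} {a : Expo}
    (h : (a : ℚ≥0).den ∣ denLcm q a) :
    (a : ℚ≥0) ∈ levels q ↔ ¬ (a : ℚ≥0).den ∣ denLcmAbove q a := by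
  rw [mem_levels_iff]
  refine ⟨fun h => h.2, fun h' => ⟨fun h0 => h' (h.trans ?_), h'⟩⟩
  refine denLcm_dvd_iff.2 fun k hk hk0 => ?_
  rcases hk.eq_or_lt with rfl | hk
  · exact absurd h0 hk0
  · exact den_dvd_denLcmAbove hk hk0

theorem levels_gal (n : ℤ) (q : PuiseuxPart) (k : Expo) :
    (k : ℚ≥0) ∈ levels (gal n q) ↔ (k : ℚ≥0) ∈ levels q := by
  rw [mem_levels_iff, mem_levels_iff, gal_ne_zero_iff, denLcmAbove_gal]

theorem Agree.mem_levels_iff {t k : Expo} {p q : PuiseuxPart} (h : Agree t p q) (hk : t ≤ k) :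
    (k : ℚ≥0) ∈ levels p ↔ (k : ℚ≥0) ∈ levels q := by
  rw [Fission.mem_levels_iff, Fission.mem_levels_iff, h k hk, (h.mono hk).above.denLcmAbove_eq]

/-! ### Fission exponents -/

theorem gal_ram (q : PuiseuxPart) : gal (ram q) q = q := by
  ext k
  refine ((gal_apply_self_iff _ _ _).2 fun h => ?_).symm
  exact Int.natCast_dvd_natCast.2 (Finset.dvd_lcm (Finsupp.mem_support_iff.2 h))

theorem gal_emod {q : PuiseuxPart} {r : ℕ} (h : gal r q = q) (n : ℤ) : gal (n % r) q = gal n q := by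
  have hr : ∀ k : Expo, q k ≠ 0 → (((k : ℚ≥0).den : ℕ) : ℤ) ∣ r := fun k =>
    (gal_apply_self_iff _ _ _).1 (by rw [h])
  ext k
  rw [gal_apply_eq_iff, gal_apply_self_iff]
  intro h0
  exact (hr k h0).trans ⟨n / r, by have := Int.emod_add_mul_ediv n r; linarith⟩

theorem exists_nat_agree_gal_iff (t : Expo) (p q : PuiseuxPart) :
    (∃ n : ℕ, Agree t (gal n p) q) ↔ ∃ n : ℤ, Agree t p (gal n q) := by
  constructor
  · rintro ⟨n, h⟩
    refine ⟨-n, ?_⟩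
    rw [← zero_sub, ← agree_gal_iff, gal_zero]
    exact h
  · rintro ⟨n, h⟩
    refine ⟨(-n % ram p).toNat, ?_⟩
    rw [Int.toNat_of_nonneg (Int.emod_nonneg _ (by exact_mod_cast (ram_pos p).ne')),
      gal_emod (gal_ram p)]
    have := h.gal (-n)
    rwa [gal_gal, neg_add_cancel, gal_zero] at this

theorem sameCircle_trunc_iff (k : Expo) (p q : PuiseuxPart) :
    SameCircle (trunc k p) (trunc k q) ↔ ∃ n : ℤ, Agree k p (gal n q) := by
  rw [← exists_nat_agree_gal_iff, SameCircle]
  refine exists_congr fun n => ?_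
  rw [galois_iterate, Finsupp.ext_iff]
  refine forall_congr' fun l => ?_
  rw [gal_apply, gal_apply, trunc, trunc, Finsupp.filter_apply, Finsupp.filter_apply]
  have : (k : ℚ≥0) ≤ l ↔ k ≤ l := Iff.rfl
  by_cases h : (k : ℚ≥0) ≤ l
  · simp [h, this.1 h]
  · simp only [h, if_false, mul_zero, true_iff]
    exact fun h' => absurd h' h

theorem inCommonRange_iff (p q : PuiseuxPart) (l : ℚ≥0) :
    InCommonRange p q l ↔ ∃ k : Expo, p k ≠ 0 ∧ (k : ℚ≥0) ≤ l ∧ ∃ n : ℤ, Agree k p (gal n q) := by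
  refine exists_congr fun k => ?_
  rw [Finsupp.mem_support_iff, sameCircle_trunc_iff]

open Classical in
theorem fissionExponent_lt_iff (p q : PuiseuxPart) (t : Expo) :
    fissionExponent p q < t ↔ ∃ n : ℤ, Agree t p (gal n q) := by
  have hfil : ∀ u : PuiseuxPart,
      slope (u.filter fun l => ¬ InCommonRange p q l) < t ↔
        ∀ l : Expo, t ≤ l → u l ≠ 0 → InCommonRange p q l := by
    intro u
    rw [slope_lt_iff]
    refine forall₂_congr fun l _ => ?_
    by_cases h : InCommonRange p q l <;> simp [h]
  rw [fissionExponent, max_lt_iff, hfil, hfil]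
  constructor
  · rintro ⟨h1, h2⟩
    have hfin : {l : Expo | t ≤ l ∧ (p l ≠ 0 ∨ q l ≠ 0)}.Finite := by
      refine (p.support.finite_toSet.union q.support.finite_toSet).subset ?_
      rintro l ⟨-, h | h⟩
      · exact Or.inl (Finsupp.mem_support_iff.2 h)
      · exact Or.inr (Finsupp.mem_support_iff.2 h)
    by_cases hne : {l : Expo | t ≤ l ∧ (p l ≠ 0 ∨ q l ≠ 0)}.Nonempty
    · obtain ⟨l, ⟨htl, hl⟩, hmin⟩ := hfin.exists_minimal hne
      have hcr : InCommonRange p q l := hl.elim (h1 l htl) (h2 l htl)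
      obtain ⟨k, -, hkl, n, hn⟩ := (inCommonRange_iff p q l).1 hcr
      refine ⟨n, fun j hj => ?_⟩
      by_cases hjl : p j ≠ 0 ∨ q j ≠ 0
      · have hlj : l ≤ j := (le_total l j).elim id fun h => hmin ⟨hj, hjl⟩ h
        exact hn j (le_trans (show k ≤ l from hkl) hlj)
      · push Not at hjl
        rw [gal_apply, hjl.1, hjl.2, mul_zero]
    · refine ⟨0, fun j hj => ?_⟩
      have hjl : ¬ (p j ≠ 0 ∨ q j ≠ 0) := fun h => hne ⟨j, hj, h⟩
      push Not at hjl
      rw [gal_apply, hjl.1, hjl.2, mul_zero]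
  · rintro ⟨n, hn⟩
    have h1 : ∀ l : Expo, t ≤ l → p l ≠ 0 → InCommonRange p q l := fun l htl hl =>
      (inCommonRange_iff p q l).2 ⟨l, hl, le_rfl, n, hn.mono htl⟩
    refine ⟨h1, fun l htl hl => h1 l htl ?_⟩
    rw [hn l htl]
    exact (gal_ne_zero_iff n q l).2 hl

theorem fissionExponent_self_lt (p : PuiseuxPart) (t : Expo) : fissionExponent p p < t :=
  (fissionExponent_lt_iff p p t).2 ⟨0, by rw [gal_zero]; exact Agree.refl _ _⟩

theorem fissionExponent_lt_symm {p q : PuiseuxPart} {t : Expo} (h : fissionExponent p q < t) :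
    fissionExponent q p < t := by
  rw [fissionExponent_lt_iff] at h ⊢
  obtain ⟨n, hn⟩ := h
  refine ⟨-n, ?_⟩
  rw [← zero_sub, ← agree_gal_iff, gal_zero]
  exact hn.symm

theorem fissionExponent_lt_trans {p q u : PuiseuxPart} {t : Expo} (h : fissionExponent p q < t)
    (h' : fissionExponent q u < t) : fissionExponent p u < t := by
  rw [fissionExponent_lt_iff] at h h' ⊢
  obtain ⟨n, hn⟩ := h
  obtain ⟨k, hk⟩ := h'
  exact ⟨n + k, by rw [← gal_gal]; exact hn.trans (hk.gal n)⟩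

/-! ### Compatible representatives -/

theorem exists_compatible_shifts {ι : Type*} [DecidableEq ι] (q : ι → PuiseuxPart)
    (S : Finset ι) :
    ∃ c : ι → ℤ, ∀ i ∈ S, ∀ j ∈ S, ∀ t : Expo, fissionExponent (q i) (q j) < t →
      Agree t (gal (c i) (q i)) (gal (c j) (q j)) := by
  induction S using Finset.induction_on with
  | empty => exact ⟨0, by simp⟩
  | insert a S ha ih =>
    obtain ⟨c, hc⟩ := ih
    by_cases hS : S.Nonempty
    · obtain ⟨b, hb, hmin⟩ := S.exists_min_image (fun i => fissionExponent (q i) (q a)) hS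
      have hex : ∃ n : ℤ, ∀ t : Expo, fissionExponent (q b) (q a) < t →
          Agree t (gal (c b) (q b)) (gal n (q a)) := by
        have hfin : {l : Expo | fissionExponent (q b) (q a) < l ∧
            (q b l ≠ 0 ∨ q a l ≠ 0)}.Finite := by
          refine ((q b).support.finite_toSet.union (q a).support.finite_toSet).subset ?_
          rintro l ⟨-, h | h⟩
          · exact Or.inl (Finsupp.mem_support_iff.2 h)
          · exact Or.inr (Finsupp.mem_support_iff.2 h)
        by_cases hne : {l : Expo | fissionExponent (q b) (q a) < l ∧
            (q b l ≠ 0 ∨ q a l ≠ 0)}.Nonempty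
        · obtain ⟨l, ⟨hl, -⟩, hlmin⟩ := hfin.exists_minimal hne
          obtain ⟨n, hn⟩ := (fissionExponent_lt_iff _ _ _).1 hl
          refine ⟨c b + n, fun t ht k hk => ?_⟩
          rw [gal_apply_eq_iff, add_sub_cancel_left]
          by_cases h0 : q b k ≠ 0 ∨ q a k ≠ 0
          · have hfk : fissionExponent (q b) (q a) < k := ht.trans_le hk
            exact hn k ((le_total l k).elim id fun h => hlmin ⟨hfk, h0⟩ h)
          · push Not at h0
            rw [gal_apply, h0.1, h0.2, mul_zero]
        · refine ⟨0, fun t ht k hk => ?_⟩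
          have h0 : ¬ (q b k ≠ 0 ∨ q a k ≠ 0) := fun h => hne ⟨k, ht.trans_le hk, h⟩
          push Not at h0
          rw [gal_apply, gal_apply, h0.1, h0.2, mul_zero, mul_zero]
      obtain ⟨n, hn⟩ := hex
      have key : ∀ i ∈ S, ∀ t : Expo, fissionExponent (q i) (q a) < t →
          Agree t (gal (c i) (q i)) (gal n (q a)) := by
        intro i hi t ht
        have hba : fissionExponent (q b) (q a) < t := (hmin i hi).trans_lt ht
        exact (hc i hi b hb t
          (fissionExponent_lt_trans ht (fissionExponent_lt_symm hba))).trans (hn t hba)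
      refine ⟨Function.update c a n, fun i hi j hj t ht => ?_⟩
      have hup : ∀ i ∈ S, Function.update c a n i = c i := fun i hi =>
        Function.update_of_ne (ne_of_mem_of_not_mem hi ha) _ _
      rcases Finset.mem_insert.1 hi with hia | hi <;> rcases Finset.mem_insert.1 hj with hja | hj
      · rw [hia, hja]
        exact Agree.refl _ _
      · rw [hia] at ht ⊢
        rw [Function.update_self, hup j hj]
        exact (key j hj t (fissionExponent_lt_symm ht)).symm
      · rw [hja] at ht ⊢
        rw [Function.update_self, hup i hi]
        exact key i hi t ht
      · rw [hup i hi, hup j hj]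
        exact hc i hi j hj t ht
    · rw [Finset.not_nonempty_iff_eq_empty] at hS
      subst hS
      refine ⟨0, fun i hi j hj t _ => ?_⟩
      rw [insert_empty_eq, Finset.mem_singleton] at hi hj
      rw [hi, hj]
      exact Agree.refl _ _

/-! ### Compatible families -/

/-- The members of the family `p` agree as far as some conjugates of them do. -/
def IsCompatible {ι : Type*} (p : ι → PuiseuxPart) : Prop :=
  ∀ i j, ∀ t : Expo, (∃ n : ℤ, Agree t (p i) (gal n (p j))) → Agree t (p i) (p j)

/-- The conditions on the coefficients of `p'` that express numerical equivalence with the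
compatible family `p`. -/
structure CoeffConditions {ι : Type*} (p p' : ι → PuiseuxPart) : Prop where
  admissible : ∀ i, ∀ a : Expo, p' i a ≠ 0 → (a : ℚ≥0).den ∣ denLcm (p i) a
  mandatory : ∀ i, ∀ a : Expo, (a : ℚ≥0) ∈ levels (p i) → p' i a ≠ 0
  glue : ∀ i j, ∀ a : Expo, Agree a (p i) (p j) → p' i a = p' j a
  separate : ∀ i j, ∀ a : Expo, AgreeAbove a (p i) (p j) → ¬ Agree a (p i) (p j) →
    (a : ℚ≥0).den ∣ denLcm (p i) a → (a : ℚ≥0).den ∣ denLcm (p j) a →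
    p' i a ^ (denLcm (p i) a / denLcmAbove (p i) a) ≠
      p' j a ^ (denLcm (p i) a / denLcmAbove (p i) a)

theorem coeffConditions_of_agree_iff {ι : Type*} {p p' : ι → PuiseuxPart} (hp : IsCompatible p)
    (h : ∀ i j t n, Agree t (p' i) (gal n (p' j)) ↔ Agree t (p i) (gal n (p j))) :
    CoeffConditions p p' where
  admissible i a h0 := by
    have := (h i i a (denLcm (p i) a)).2 ((agree_gal_self_iff _ _ _).2 dvd_rfl)
    exact Int.natCast_dvd_natCast.1 ((gal_apply_self_iff _ _ _).1 (this a le_rfl) h0)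
  mandatory i a ha := by
    obtain ⟨-, hd⟩ := (mem_levels_iff _ _).1 ha
    intro h0
    have hA : AgreeAbove a (p i) (gal (denLcmAbove (p i) a) (p i)) :=
      (agreeAbove_gal_self_iff _ _ _).2 dvd_rfl
    have hA' : Agree a (p' i) (gal (denLcmAbove (p i) a) (p' i)) := by
      rw [agree_iff_above]
      refine ⟨?_, by rw [gal_apply, h0, mul_zero]⟩
      rw [agreeAbove_iff] at hA ⊢
      exact fun s hs => (h _ _ _ _).2 (hA s hs)
    have hB := (h _ _ _ _).1 hA'
    refine hd (Int.natCast_dvd_natCast.1 ?_)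
    exact (gal_apply_self_iff _ _ _).1 (hB a le_rfl) ((mem_levels_iff _ _).1 ha).1
  glue i j a hA := by
    have := (h i j a 0).2 (by rwa [gal_zero]) a le_rfl
    rwa [gal_zero] at this
  separate i j a hab hnot hi hj heq := by
    rw [denLcm_eq_lcm hi, pow_eq_pow_iff_exists_chi a _ (denLcmAbove_pos _ _)] at heq
    obtain ⟨n, hn, heq⟩ := heq
    refine hnot (hp i j a ⟨n, (h i j a n).1 (agree_iff_above.2 ⟨?_, heq⟩)⟩)
    rw [hab.denLcmAbove_eq, ← agreeAbove_gal_self_iff] at hn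
    rw [agreeAbove_iff] at hab hn ⊢
    exact fun s hs => (h _ _ _ _).2 ((hab s hs).trans (hn s hs))

theorem CoeffConditions.agree_iff {ι : Type*} {p p' : ι → PuiseuxPart}
    (hc : CoeffConditions p p') (i j : ι) (t : Expo) (n : ℤ) :
    Agree t (p' i) (gal n (p' j)) ↔ Agree t (p i) (p j) ∧ (denLcm (p i) t : ℤ) ∣ n := by
  have hlev : ∀ s : Expo, Agree s (p i) (p j) → Agree s (p' i) (gal n (p' j)) →
      denLcm (p i) s ∣ n.natAbs := by
    intro s hs h
    rw [← forall_levels_dvd_iff]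
    intro l hl hsl
    have hsl' : s ≤ ⟨l, hl.1⟩ := hsl
    have h1 := h _ hsl'
    rw [gal_apply, ← hc.glue i j _ (hs.mono hsl'), ← gal_apply] at h1
    exact Int.natCast_dvd.1 ((gal_apply_self_iff _ _ _).1 h1 (hc.mandatory i _ hl))
  constructor
  · intro h
    have hij : Agree t (p i) (p j) := by
      by_contra hnot
      have hfin : {l : Expo | t ≤ l ∧ p i l ≠ p j l}.Finite := by
        refine ((p i).support.finite_toSet.union (p j).support.finite_toSet).subset ?_
        rintro l ⟨-, hl⟩
        by_contra h0
        simp only [Set.mem_union, Finset.mem_coe, Finsupp.mem_support_iff, not_or, not_not] at h0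
        exact hl (h0.1.trans h0.2.symm)
      have hne : {l : Expo | t ≤ l ∧ p i l ≠ p j l}.Nonempty := by
        by_contra hne
        refine hnot fun k hk => ?_
        by_contra hk'
        exact hne ⟨k, hk, hk'⟩
      obtain ⟨f, ⟨htf, hf⟩, hmax⟩ := hfin.exists_maximal hne
      have hab : AgreeAbove f (p i) (p j) := by
        intro k hk
        by_contra hk'
        exact absurd (hmax ⟨htf.trans hk.le, hk'⟩ hk.le) (not_le.2 hk)
      have hnf : ¬ Agree f (p i) (p j) := fun h => hf (h f le_rfl)
      have hdvd : denLcmAbove (p i) f ∣ n.natAbs := by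
        rw [denLcmAbove_dvd_iff]
        intro k hk hk0
        refine (den_dvd_denLcm le_rfl hk0).trans (hlev k (agreeAbove_iff.1 hab k hk) ?_)
        exact h.mono (htf.trans hk.le)
      have hf' := h f htf
      by_cases hi : (f : ℚ≥0).den ∣ denLcm (p i) f <;> by_cases hj : (f : ℚ≥0).den ∣ denLcm (p j) f
      · refine hc.separate i j f hab hnf hi hj ?_
        rw [denLcm_eq_lcm hi, pow_eq_pow_iff_exists_chi f _ (denLcmAbove_pos _ _)]
        exact ⟨n, Int.natCast_dvd.2 hdvd, hf'⟩
      · have h0 : p' j f = 0 := by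
          by_contra h0
          exact hj (hc.admissible j f h0)
        have h0' : p' i f = 0 := by rw [hf', gal_apply, h0, mul_zero]
        by_cases hl : (f : ℚ≥0) ∈ levels (p i)
        · exact hc.mandatory i f hl h0'
        · rw [mem_levels_iff_of_admissible hi, not_not, hab.denLcmAbove_eq] at hl
          exact hj (hl.trans (denLcmAbove_dvd_denLcm _ _))
      · have h0' : p' i f = 0 := by
          by_contra h0
          exact hi (hc.admissible i f h0)
        have h0 : p' j f = 0 := by
          rw [hf', gal_apply, mul_eq_zero] at h0'
          exact h0'.resolve_left (zpow_ne_zero _ (chi_ne_zero f))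
        by_cases hl : (f : ℚ≥0) ∈ levels (p j)
        · exact hc.mandatory j f hl h0
        · rw [mem_levels_iff_of_admissible hj, not_not, ← hab.denLcmAbove_eq] at hl
          exact hi (hl.trans (denLcmAbove_dvd_denLcm _ _))
      · have h0 : p i f = 0 := by
          by_contra h0
          exact hi (den_dvd_denLcm le_rfl h0)
        have h0' : p j f = 0 := by
          by_contra h0
          exact hj (den_dvd_denLcm le_rfl h0)
        exact hf (h0.trans h0'.symm)
    exact ⟨hij, Int.natCast_dvd.2 (hlev t hij h)⟩
  · rintro ⟨hij, hn⟩ k hk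
    rw [gal_apply, ← hc.glue i j k (hij.mono hk), ← gal_apply, gal_apply_self_iff]
    intro h0
    refine (Int.natCast_dvd_natCast.2 ?_).trans hn
    exact (hc.admissible i k h0).trans (denLcm_anti hk)

theorem coeffConditions_iff {ι : Type*} {p p' : ι → PuiseuxPart} (hp : IsCompatible p) :
    CoeffConditions p p' ↔
      ∀ i j t n, Agree t (p' i) (gal n (p' j)) ↔ Agree t (p i) (gal n (p j)) := by
  refine ⟨fun h i j t n => ?_, coeffConditions_of_agree_iff hp⟩
  rw [h.agree_iff,
    (coeffConditions_of_agree_iff hp fun _ _ _ _ => Iff.rfl : CoeffConditions p p).agree_iff]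

/-! ### Numerical equivalence -/

theorem numEquiv_iff {m : ℕ} {Q' Q : Fin m → ℕ × PuiseuxPart} (hm : ∀ i, (Q' i).1 = (Q i).1) :
    NumEquiv Q' Q ↔ ∀ i j t n, Agree t (Q' i).2 (gal n (Q' j).2) ↔
      Agree t (Q i).2 (gal n (Q j).2) := by
  constructor
  · rintro ⟨-, h⟩
    have h' : ∀ i j, ∀ k l : ℕ, k ≤ ram (Q i).2 → l ≤ ram (Q j).2 → ∀ t,
        (Agree t (gal k (Q' i).2) (gal l (Q' j).2) ↔ Agree t (gal k (Q i).2) (gal l (Q j).2)) := by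
      intro i j k l hk hl t
      have := (eq_iff_forall_lt_iff _ _).1 (h i j k l hk hl) t
      simpa only [galois_iterate, slope_sub_lt_iff] using this
    have hram : ∀ j, gal (ram (Q j).2) (Q' j).2 = (Q' j).2 := by
      intro j
      ext k
      refine ((h' j j (ram (Q j).2) 0 le_rfl (Nat.zero_le _) k).2 ?_) k le_rfl |>.trans ?_
      · rw [gal_ram, Nat.cast_zero, gal_zero]
        exact Agree.refl _ _
      · rw [Nat.cast_zero, gal_zero]
    intro i j t n
    have hpos : (0 : ℤ) < ram (Q j).2 := by exact_mod_cast ram_pos (Q j).2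
    rw [← gal_emod (hram j) n, ← gal_emod (gal_ram (Q j).2) n]
    obtain ⟨l, hl⟩ := Int.eq_ofNat_of_zero_le (Int.emod_nonneg n hpos.ne')
    have hlt := Int.emod_lt_of_pos n hpos
    rw [hl] at hlt ⊢
    have := h' i j 0 l (Nat.zero_le _) (by omega) t
    simpa only [Nat.cast_zero, gal_zero] using this
  · intro h
    refine ⟨hm, fun i j k l _ _ => (eq_iff_forall_lt_iff _ _).2 fun t => ?_⟩
    rw [galois_iterate, galois_iterate, galois_iterate, galois_iterate, slope_sub_lt_iff,
      slope_sub_lt_iff, agree_gal_iff, agree_gal_iff]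
    exact h i j t _

/-! ### The fission tree of an irregular type -/

section Tree

variable {m : ℕ} (Q : Fin m → ℕ × PuiseuxPart)

theorem pos_of_mem_exponents {a : ℚ≥0} (ha : a ∈ (fissionDatum Q).exponents) : 0 < a := by
  obtain ⟨i, hi⟩ := ha
  exact hi.1

theorem mem_exponents_of_den_dvd {i : Fin m} {a : Expo}
    (h : (a : ℚ≥0).den ∣ denLcm (Q i).2 a) : (a : ℚ≥0) ∈ (fissionDatum Q).exponents :=
  ⟨i, (mem_admissibleExponents_iff _ _).2 h⟩

theorem mem_exponents_of_ne_zero {i : Fin m} {a : Expo} (h : (Q i).2 a ≠ 0) :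
    (a : ℚ≥0) ∈ (fissionDatum Q).exponents :=
  mem_exponents_of_den_dvd Q (i := i) (den_dvd_denLcm le_rfl h)

theorem den_dvd_totalRam {a : ℚ≥0} (ha : a ∈ (fissionDatum Q).exponents) :
    a.den ∣ totalRam Q := by
  have hpos := pos_of_mem_exponents Q ha
  obtain ⟨i, hi⟩ := ha
  have h := (mem_admissibleExponents_iff (Q i).2 ⟨a, hpos⟩).1 hi
  exact h.trans ((denLcm_dvd_ram _ _).trans
    (Finset.dvd_lcm (f := fun i => ram (Q i).2) (Finset.mem_univ i)))

theorem natCast_mem_exponents (i : Fin m) {n : ℕ} (hn : 0 < n) :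
    (n : ℚ≥0) ∈ (fissionDatum Q).exponents :=
  ⟨i, Nat.cast_pos.2 hn, Or.inl ⟨n, rfl⟩⟩

/-- `t` is the smallest exponent that is greater than `s`. -/
def IsNext (s t : ℚ≥0) : Prop := IsLeast {a ∈ (fissionDatum Q).exponents | s < a} t

theorem exists_isNext_of_mem {a s : ℚ≥0} (ha : a ∈ (fissionDatum Q).exponents) (hs : s < a) :
    ∃ t, IsNext Q s t := by
  classical
  have hr : (0 : ℚ≥0) < totalRam Q := Nat.cast_pos.2 (totalRam_pos Q)
  have key : ∀ b ∈ (fissionDatum Q).exponents, ∃ n : ℕ, b = n / totalRam Q := by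
    intro b hb
    obtain ⟨n, hn⟩ := (den_dvd_iff _ _).1 (den_dvd_totalRam Q hb)
    exact ⟨n, by rw [← hn, mul_div_cancel_right₀ _ hr.ne']⟩
  have hex : ∃ n : ℕ, (n / totalRam Q : ℚ≥0) ∈ (fissionDatum Q).exponents ∧
      s < (n / totalRam Q : ℚ≥0) := by
    obtain ⟨n, hn⟩ := key a ha
    exact ⟨n, hn ▸ ha, hn ▸ hs⟩
  refine ⟨_, Nat.find_spec hex, ?_⟩
  rintro b ⟨hb, hsb⟩
  obtain ⟨n, rfl⟩ := key b hb
  have : Nat.find hex ≤ n := Nat.find_min' hex ⟨hb, hsb⟩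
  exact div_le_div_of_nonneg_right (Nat.cast_le.2 this) hr.le

theorem exists_isNext (i : Fin m) (s : ℚ≥0) : ∃ t, IsNext Q s t := by
  refine exists_isNext_of_mem Q (natCast_mem_exponents Q i (Nat.succ_pos ⌊s⌋₊)) ?_
  push_cast
  exact Nat.lt_floor_add_one s

variable {Q} in
theorem IsNext.lt {s t : ℚ≥0} (h : IsNext Q s t) : s < t := h.1.2

variable {Q} in
theorem IsNext.mem {s t : ℚ≥0} (h : IsNext Q s t) : t ∈ (fissionDatum Q).exponents := h.1.1

variable {Q} in
theorem IsNext.le {s t a : ℚ≥0} (h : IsNext Q s t) (ha : a ∈ (fissionDatum Q).exponents)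
    (hs : s < a) : t ≤ a := h.2 ⟨ha, hs⟩

variable {Q} in
theorem IsNext.unique {s t t' : ℚ≥0} (h : IsNext Q s t) (h' : IsNext Q s t') : t = t' :=
  IsLeast.unique h h'

variable {Q} in
theorem IsNext.unique_left {s s' t : ℚ≥0} (h : IsNext Q s t) (h' : IsNext Q s' t)
    (hs : s = 0 ∨ s ∈ (fissionDatum Q).exponents)
    (hs' : s' = 0 ∨ s' ∈ (fissionDatum Q).exponents) : s = s' := by
  have key : ∀ {x y : ℚ≥0}, IsNext Q x t → IsNext Q y t →
      (y = 0 ∨ y ∈ (fissionDatum Q).exponents) → ¬ x < y := by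
    intro x y hx hy hy' hxy
    rcases hy' with rfl | hy'
    · exact absurd hxy (not_lt.2 zero_le)
    · exact absurd (hx.le hy' hxy) (not_le.2 hy.lt)
  exact le_antisymm (not_lt.1 (key h' h hs)) (not_lt.1 (key h h' hs'))

theorem point_eq_iff (i j : Fin m) (s t : ℝ≥0) :
    (fissionDatum Q).point i s = (fissionDatum Q).point j t ↔
      s = t ∧ (i = j ∨ ∃ a ∈ (fissionDatum Q).exponents,
        fissionExponent (Q i).2 (Q j).2 < a ∧ (a : ℝ≥0) ≤ s) := by
  constructor
  · intro h
    have h' := Quot.eqvGen_exact h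
    generalize hx : (i, s) = x at h'
    generalize hy : (j, t) = y at h'
    suffices H : x.2 = y.2 ∧ (x.1 = y.1 ∨ ∃ a ∈ (fissionDatum Q).exponents,
        fissionExponent (Q x.1).2 (Q y.1).2 < a ∧ (a : ℝ≥0) ≤ x.2) by
      subst hx hy
      exact H
    clear hx hy h
    induction h' with
    | rel x y h =>
      obtain ⟨h1, g, hg, hgt⟩ := h
      exact ⟨h1, Or.inr ⟨g, hg.1.1, hg.1.2, hgt⟩⟩
    | refl x => exact ⟨rfl, Or.inl rfl⟩
    | symm x y _ ih =>
      refine ⟨ih.1.symm, ih.2.imp Eq.symm ?_⟩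
      rintro ⟨a, ha, hf, hle⟩
      exact ⟨a, ha, fissionExponent_lt_symm (t := ⟨a, pos_of_mem_exponents Q ha⟩) hf, ih.1 ▸ hle⟩
    | trans x y z _ _ ih1 ih2 =>
      refine ⟨ih1.1.trans ih2.1, ?_⟩
      rcases ih1.2 with h1 | ⟨a, ha, hfa, hla⟩
      · rw [h1, ih1.1]
        exact ih2.2
      · rcases ih2.2 with h2 | ⟨b, hb, hfb, hlb⟩
        · rw [← h2]
          exact Or.inr ⟨a, ha, hfa, hla⟩
        · rw [← ih1.1] at hlb
          right
          rcases le_total a b with hab | hab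
          · exact ⟨b, hb, fissionExponent_lt_trans (t := ⟨b, pos_of_mem_exponents Q hb⟩)
              (hfa.trans_le hab) hfb, hlb⟩
          · exact ⟨a, ha, fissionExponent_lt_trans (t := ⟨a, pos_of_mem_exponents Q ha⟩)
              hfa (hfb.trans_le hab), hla⟩
  · rintro ⟨rfl, rfl | ⟨a, ha, hf, hle⟩⟩
    · rfl
    · refine Quot.sound ⟨rfl, ?_⟩
      obtain ⟨g, hg⟩ := exists_isNext_of_mem Q ha hf
      refine ⟨g, hg, le_trans ?_ hle⟩
      exact NNRat.cast_le.2 (hg.le ha hf)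

theorem point_eq_point_of_le {i j : Fin m} {s t : ℝ≥0} (hst : s ≤ t)
    (h : (fissionDatum Q).point i s = (fissionDatum Q).point j s) :
    (fissionDatum Q).point i t = (fissionDatum Q).point j t := by
  rw [point_eq_iff] at h ⊢
  refine ⟨rfl, h.2.imp_right ?_⟩
  rintro ⟨a, ha, hf, hle⟩
  exact ⟨a, ha, hf, hle.trans hst⟩

theorem height_point (i : Fin m) (t : ℝ≥0) :
    (fissionDatum Q).height ((fissionDatum Q).point i t) = t := rfl

theorem lt_of_point_eq {i j : Fin m} {a : Expo} {t : ℝ≥0}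
    (h : (fissionDatum Q).point i ((a : ℚ≥0) : ℝ≥0) = (fissionDatum Q).point j t) :
    fissionExponent (Q i).2 (Q j).2 < a := by
  rw [point_eq_iff] at h
  rcases h.2 with rfl | ⟨b, -, hf, hle⟩
  · exact fissionExponent_self_lt _ _
  · exact hf.trans_le (NNRat.cast_le.1 hle)

theorem point_eq_iff_of_mem (i j : Fin m) (a : Expo)
    (ha : (a : ℚ≥0) ∈ (fissionDatum Q).exponents) :
    (fissionDatum Q).point i ((a : ℚ≥0) : ℝ≥0) = (fissionDatum Q).point j ((a : ℚ≥0) : ℝ≥0) ↔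
      fissionExponent (Q i).2 (Q j).2 < a :=
  ⟨lt_of_point_eq Q, fun h => (point_eq_iff Q _ _ _ _).2 ⟨rfl, Or.inr ⟨a, ha, h, le_rfl⟩⟩⟩

theorem denLcm_eq_of_lt {p q : PuiseuxPart} {t : Expo} (h : fissionExponent p q < t) :
    denLcm p t = denLcm q t := by
  obtain ⟨n, hn⟩ := (fissionExponent_lt_iff _ _ _).1 h
  rw [hn.denLcm_eq, denLcm_gal]

theorem mem_levels_of_lt {p q : PuiseuxPart} {t : Expo} (h : fissionExponent p q < t) :
    (t : ℚ≥0) ∈ levels p ↔ (t : ℚ≥0) ∈ levels q := by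
  obtain ⟨n, hn⟩ := (fissionExponent_lt_iff _ _ _).1 h
  rw [hn.mem_levels_iff le_rfl, levels_gal]

theorem point_mem_admissibleVertices_iff (i : Fin m) (a : Expo) :
    (fissionDatum Q).point i ((a : ℚ≥0) : ℝ≥0) ∈ (fissionDatum Q).admissibleVertices ↔
      (a : ℚ≥0).den ∣ denLcm (Q i).2 a := by
  constructor
  · rintro ⟨j, b, hb, h⟩
    have hab : (a : ℚ≥0) = b := NNRat.cast_injective ((point_eq_iff _ _ _ _ _).1 h).1
    subst hab
    rw [denLcm_eq_of_lt (lt_of_point_eq Q h)]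
    exact (mem_admissibleExponents_iff _ _).1 hb
  · intro h
    exact ⟨i, a, (mem_admissibleExponents_iff _ _).2 h, rfl⟩

theorem point_mem_mandatoryVertices_iff (i : Fin m) (a : Expo) :
    (fissionDatum Q).point i ((a : ℚ≥0) : ℝ≥0) ∈ (fissionDatum Q).mandatoryVertices ↔
      (a : ℚ≥0) ∈ levels (Q i).2 := by
  constructor
  · rintro ⟨j, b, hb, h⟩
    have hab : (a : ℚ≥0) = b := NNRat.cast_injective ((point_eq_iff _ _ _ _ _).1 h).1
    subst hab
    exact (mem_levels_of_lt (lt_of_point_eq Q h)).2 hb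
  · intro h
    exact ⟨i, a, h, rfl⟩

theorem point_mem_vertices_iff (i : Fin m) (t : ℝ≥0) :
    (fissionDatum Q).point i t ∈ (fissionDatum Q).vertices ↔
      ∃ s : ℚ≥0, (s = 0 ∨ s ∈ (fissionDatum Q).exponents) ∧ t = s := by
  constructor
  · rintro (h | ⟨a, ha, h⟩)
    · exact ⟨0, Or.inl rfl, by rw [NNRat.cast_zero]; exact h⟩
    · exact ⟨a, Or.inr ha, h⟩
  · rintro ⟨s, rfl | hs, rfl⟩
    · exact Or.inl (by rw [height_point, NNRat.cast_zero])
    · exact Or.inr ⟨s, hs, rfl⟩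

theorem isChild_iff (w v : (fissionDatum Q).Tree) :
    (fissionDatum Q).IsChild w v ↔ ∃ i, ∃ s t : ℚ≥0, (s = 0 ∨ s ∈ (fissionDatum Q).exponents) ∧
      IsNext Q s t ∧ w = (fissionDatum Q).point i s ∧ v = (fissionDatum Q).point i t := by
  constructor
  · rintro ⟨hw, hv, hne, ⟨i, s, t, hst, rfl, rfl⟩, hbtw⟩
    obtain ⟨s, hs, rfl⟩ := (point_mem_vertices_iff Q _ _).1 hw
    obtain ⟨t, ht, rfl⟩ := (point_mem_vertices_iff Q _ _).1 hv
    rw [NNRat.cast_le] at hst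
    have hlt : s < t := hst.lt_of_ne fun h => hne (by rw [h])
    have htA := ht.resolve_left ((zero_le).trans_lt hlt).ne'
    obtain ⟨g, hg⟩ := exists_isNext Q i s
    refine ⟨i, s, t, hs, ?_, rfl, rfl⟩
    have hgt := hg.le htA hlt
    have := hbtw ((fissionDatum Q).point i g)
      ((point_mem_vertices_iff Q _ _).2 ⟨g, Or.inr hg.mem, rfl⟩)
      ⟨i, _, _, NNRat.cast_le.2 hg.lt.le, rfl, rfl⟩ ⟨i, _, _, NNRat.cast_le.2 hgt, rfl, rfl⟩
    rcases this with h | h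
    · exact absurd (NNRat.cast_injective (congrArg (fissionDatum Q).height h)) hg.lt.ne'
    · rwa [← show g = t from NNRat.cast_injective (congrArg (fissionDatum Q).height h)]
  · rintro ⟨i, s, t, hs, ht, rfl, rfl⟩
    refine ⟨(point_mem_vertices_iff Q _ _).2 ⟨s, hs, rfl⟩,
      (point_mem_vertices_iff Q _ _).2 ⟨t, Or.inr ht.mem, rfl⟩,
      fun h => ht.lt.ne (NNRat.cast_injective (congrArg (fissionDatum Q).height h)),
      ⟨i, _, _, NNRat.cast_le.2 ht.lt.le, rfl, rfl⟩, ?_⟩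
    rintro u hu ⟨j, x, y, hxy, hx, rfl⟩ ⟨k, y', t', hy', hyy, htt⟩
    have hxs := (point_eq_iff Q _ _ _ _).1 hx
    have hyy' := (point_eq_iff Q _ _ _ _).1 hyy
    have htt' := (point_eq_iff Q _ _ _ _).1 htt
    obtain ⟨y, hy, rfl⟩ := (point_mem_vertices_iff Q _ _).1 hu
    rw [← hxs.1, NNRat.cast_le] at hxy
    rw [← hyy'.1, ← htt'.1, NNRat.cast_le] at hy'
    rw [← hxs.1] at hx
    rcases hxy.eq_or_lt with h | h
    · left
      rw [← h, hx]
    · right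
      have hyA := hy.resolve_left ((zero_le).trans_lt h).ne'
      rw [le_antisymm hy' (ht.le hyA h)]
      exact (point_eq_point_of_le Q (NNRat.cast_le.2 ht.lt.le) hx).symm

theorem ramIndex_point (i : Fin m) (a : Expo) :
    (fissionDatum Q).ramIndex ((fissionDatum Q).point i ((a : ℚ≥0) : ℝ≥0)) =
      denLcm (Q i).2 a := by
  rw [FissionDatum.ramIndex]
  convert sInf_multiples (denLcm_pos (Q i).2 a) using 4 with d
  refine and_congr_right fun _ => ?_
  rw [← forall_levels_dvd_iff]
  constructor
  · intro h l hl hal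
    exact h i l hl ⟨i, _, _, NNRat.cast_le.2 hal, rfl, rfl⟩
  · rintro h j k hk ⟨i', s, t, hst, hs, ht⟩
    have hs' := (point_eq_iff Q _ _ _ _).1 hs
    have ht' := (point_eq_iff Q _ _ _ _).1 ht
    rw [← hs'.1, ← ht'.1, NNRat.cast_le] at hst
    refine h k ?_ hst
    have h1 : fissionExponent (Q i).2 (Q i').2 < (⟨k, hk.1⟩ : Expo) :=
      (lt_of_point_eq Q hs).trans_le hst
    have h2 : fissionExponent (Q j).2 (Q i').2 < (⟨k, hk.1⟩ : Expo) :=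
      lt_of_point_eq Q (a := ⟨k, hk.1⟩) ht
    have h3 := fissionExponent_lt_trans h1 (fissionExponent_lt_symm h2)
    exact (mem_levels_of_lt h3).2 hk

theorem denLcmAbove_eq_denLcm {i : Fin m} {a g : Expo} (h : IsNext Q a g) :
    denLcmAbove (Q i).2 a = denLcm (Q i).2 g := by
  refine Nat.dvd_antisymm (denLcmAbove_dvd_iff.2 fun k hk h0 => ?_)
    (denLcm_dvd_iff.2 fun k hk h0 => ?_)
  · exact den_dvd_denLcm (h.le (mem_exponents_of_ne_zero Q h0) hk) h0
  · exact den_dvd_denLcmAbove (lt_of_lt_of_le (show a < g from h.lt) hk) h0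

theorem mem_admissibleChildren_iff (v w : (fissionDatum Q).Tree) :
    w ∈ (fissionDatum Q).admissibleChildren v ↔ ∃ i, ∃ a g : Expo,
      (a : ℚ≥0).den ∣ denLcm (Q i).2 a ∧ IsNext Q a g ∧
      w = (fissionDatum Q).point i ((a : ℚ≥0) : ℝ≥0) ∧
      v = (fissionDatum Q).point i ((g : ℚ≥0) : ℝ≥0) := by
  rw [FissionDatum.admissibleChildren, Set.mem_ofPred_eq, isChild_iff]
  constructor
  · rintro ⟨⟨i, s, t, -, ht, rfl, rfl⟩, hw⟩
    have hs : 0 < s := by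
      obtain ⟨j, b, hb, h⟩ := hw
      rw [show s = b from NNRat.cast_injective ((point_eq_iff _ _ _ _ _).1 h).1]
      exact hb.1
    exact ⟨i, ⟨s, hs⟩, ⟨t, hs.trans ht.lt⟩,
      (point_mem_admissibleVertices_iff Q i ⟨s, hs⟩).1 hw, ht, rfl, rfl⟩
  · rintro ⟨i, a, g, ha, hg, rfl, rfl⟩
    exact ⟨⟨i, a, g, Or.inr (mem_exponents_of_den_dvd Q ha), hg, rfl, rfl⟩,
      (point_mem_admissibleVertices_iff Q i a).2 ha⟩

theorem parent_unique {u v v' : (fissionDatum Q).Tree}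
    (h : u ∈ (fissionDatum Q).admissibleChildren v)
    (h' : u ∈ (fissionDatum Q).admissibleChildren v') : v = v' := by
  rw [mem_admissibleChildren_iff] at h h'
  obtain ⟨i, a, g, -, hg, rfl, rfl⟩ := h
  obtain ⟨j, b, g', -, hg', hu, rfl⟩ := h'
  have hab : a = b := Subtype.ext (NNRat.cast_injective ((point_eq_iff _ _ _ _ _).1 hu).1)
  subst hab
  rw [← hg.unique hg']
  exact point_eq_point_of_le Q (NNRat.cast_le.2 hg.lt.le) hu

/-- The local structure of the tree above a vertex `v` with an admissible child. -/
theorem admissibleChildren_uniform {v u w : (fissionDatum Q).Tree}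
    (hu : u ∈ (fissionDatum Q).admissibleChildren v)
    (hw : w ∈ (fissionDatum Q).admissibleChildren v) :
    (u ∈ (fissionDatum Q).mandatoryVertices ↔ w ∈ (fissionDatum Q).mandatoryVertices) ∧
      (fissionDatum Q).ramIndex u = (fissionDatum Q).ramIndex w := by
  rw [mem_admissibleChildren_iff] at hu hw
  obtain ⟨i, a, g, ha, hg, rfl, rfl⟩ := hu
  obtain ⟨j, b, g', hb, hg', rfl, hv⟩ := hw
  have hgg : g = g' := Subtype.ext (NNRat.cast_injective ((point_eq_iff _ _ _ _ _).1 hv).1)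
  subst hgg
  have hab : a = b := Subtype.ext (hg.unique_left hg' (Or.inr (mem_exponents_of_den_dvd Q ha))
    (Or.inr (mem_exponents_of_den_dvd Q hb)))
  subst hab
  have hR : denLcmAbove (Q i).2 a = denLcmAbove (Q j).2 a := by
    rw [denLcmAbove_eq_denLcm Q hg, denLcmAbove_eq_denLcm Q hg]
    exact denLcm_eq_of_lt (lt_of_point_eq Q hv)
  rw [point_mem_mandatoryVertices_iff, point_mem_mandatoryVertices_iff,
    mem_levels_iff_of_admissible ha, mem_levels_iff_of_admissible hb, ramIndex_point,
    ramIndex_point, denLcm_eq_lcm ha, denLcm_eq_lcm hb, hR]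
  exact ⟨Iff.rfl, rfl⟩

theorem ramIndex_dvd {v u : (fissionDatum Q).Tree}
    (hu : u ∈ (fissionDatum Q).admissibleChildren v) :
    0 < (fissionDatum Q).ramIndex v ∧ 0 < (fissionDatum Q).ramIndex u ∧
      (fissionDatum Q).ramIndex v ∣ (fissionDatum Q).ramIndex u ∧
      (u ∉ (fissionDatum Q).mandatoryVertices →
        (fissionDatum Q).ramIndex u = (fissionDatum Q).ramIndex v) := by
  rw [mem_admissibleChildren_iff] at hu
  obtain ⟨i, a, g, ha, hg, rfl, rfl⟩ := hu
  rw [ramIndex_point, ramIndex_point, ← denLcmAbove_eq_denLcm Q hg,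
    point_mem_mandatoryVertices_iff, mem_levels_iff_of_admissible ha, not_not]
  refine ⟨denLcmAbove_pos _ _, denLcm_pos _ _, denLcmAbove_dvd_denLcm _ _, fun h => ?_⟩
  rw [denLcm_eq_lcm ha]
  exact Nat.lcm_eq_left h

/-! ### Boundedness -/

theorem den_eq_one_of_katz_lt {i : Fin m} {a : Expo} (h : (a : ℚ≥0).den ∣ denLcm (Q i).2 a)
    (hK : katz Q < a) : (a : ℚ≥0).den = 1 := by
  refine Nat.dvd_one.1 (h.trans (denLcm_dvd_iff.2 fun k hk h0 => absurd ?_ h0))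
  refine (slope_lt_iff _ _).1 (lt_of_le_of_lt ?_ hK) k hk
  exact Finset.le_sup (f := fun i => slope (Q i).2) (Finset.mem_univ i)

theorem boundedAdmissibleVertices_finite : (boundedAdmissibleVertices Q).Finite := by
  have hr : (0 : ℚ≥0) < totalRam Q := Nat.cast_pos.2 (totalRam_pos Q)
  refine (Set.finite_range fun x : Fin m × Fin (⌊katz Q * totalRam Q⌋₊ + 1) =>
    (fissionDatum Q).point x.1 (((x.2 : ℕ) / totalRam Q : ℚ≥0) : ℝ≥0)).subset ?_
  rintro v ⟨⟨i, a, ha, rfl⟩, hv⟩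
  rw [height_point, NNRat.cast_le] at hv
  obtain ⟨n, hn⟩ := (den_dvd_iff _ _).1 (den_dvd_totalRam Q ⟨i, ha⟩)
  refine ⟨(i, ⟨n, Nat.lt_succ_of_le (Nat.le_floor ?_)⟩), ?_⟩
  · rw [← hn]
    exact mul_le_mul_of_nonneg_right hv hr.le
  · simp only
    rw [← hn, mul_div_cancel_right₀ _ hr.ne']

theorem admissibleChildren_subset {v : (fissionDatum Q).Tree} (hv : v ∈ truncatedVertices Q) :
    (fissionDatum Q).admissibleChildren v ⊆ boundedAdmissibleVertices Q := by
  intro u hu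
  refine ⟨hu.2, ?_⟩
  rw [mem_admissibleChildren_iff] at hu
  obtain ⟨i, a, g, ha, hg, rfl, rfl⟩ := hu
  have hh := hv.2
  rw [height_point, ← NNRat.cast_natCast, NNRat.cast_le] at hh
  rw [height_point, NNRat.cast_le]
  by_contra hK
  rw [not_le] at hK
  have hd := den_eq_one_of_katz_lt Q ha hK
  have hnum : (a : ℚ≥0) = (a : ℚ≥0).num := by
    rw [← NNRat.mul_den_eq_num, hd, Nat.cast_one, mul_one]
  have hlt := lt_of_lt_of_le hg.lt hh
  rw [hnum, Nat.cast_lt, Nat.floor_add_one zero_le, Nat.lt_succ_iff] at hlt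
  have := (Nat.cast_le (α := ℚ≥0)).2 hlt
  rw [← hnum] at this
  exact absurd (this.trans (Nat.floor_le zero_le)) (not_le.2 hK)

theorem exists_parent {u : (fissionDatum Q).Tree} (hu : u ∈ boundedAdmissibleVertices Q) :
    ∃ v ∈ truncatedVertices Q, u ∈ (fissionDatum Q).admissibleChildren v := by
  obtain ⟨⟨i, a, ha, rfl⟩, hK⟩ := hu
  rw [height_point, NNRat.cast_le] at hK
  obtain ⟨g, hg⟩ := exists_isNext Q i a
  refine ⟨(fissionDatum Q).point i g, ⟨?_, ?_⟩, ?_⟩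
  · exact (point_mem_vertices_iff Q _ _).2 ⟨g, Or.inr hg.mem, rfl⟩
  · rw [height_point, ← NNRat.cast_natCast, NNRat.cast_le]
    refine hg.le (natCast_mem_exponents Q i ?_) (lt_of_le_of_lt hK ?_)
    · rw [Nat.floor_add_one zero_le]
      exact Nat.succ_pos _
    · rw [Nat.floor_add_one zero_le]
      push_cast
      exact Nat.lt_floor_add_one _
  · rw [mem_admissibleChildren_iff]
    exact ⟨i, ⟨a, ha.1⟩, ⟨g, ha.1.trans hg.lt⟩,
      (mem_admissibleExponents_iff _ ⟨a, ha.1⟩).1 ha, hg, rfl, rfl⟩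

end Tree

section Coefficients

variable {m : ℕ} (Q : Fin m → ℕ × PuiseuxPart)

/-! ### Coefficients -/

theorem monomialExponent_injective : Function.Injective (monomialExponent Q) := by
  intro j k h
  have hr : (totalRam Q : ℚ≥0) ≠ 0 := (Nat.cast_pos.2 (totalRam_pos Q)).ne'
  have := congrArg Subtype.val h
  simp only [monomialExponent, div_left_inj' hr, add_left_inj, Nat.cast_inj] at this
  exact this

theorem lt_numCoeffs_iff (j : ℕ) :
    j < numCoeffs Q ↔ ((monomialExponent Q j : Expo) : ℚ≥0) ≤ katz Q := by
  have hr : (0 : ℚ≥0) < totalRam Q := Nat.cast_pos.2 (totalRam_pos Q)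
  rw [numCoeffs, ← Nat.succ_le_iff, Nat.le_floor_iff zero_le, monomialExponent, div_le_iff₀ hr,
    mul_comm]
  push_cast
  rfl

theorem exists_monomialExponent_eq {a : Expo} (hA : (a : ℚ≥0) ∈ (fissionDatum Q).exponents)
    (hK : (a : ℚ≥0) ≤ katz Q) : ∃ j : Fin (numCoeffs Q), monomialExponent Q j = a := by
  have hr : (0 : ℚ≥0) < totalRam Q := Nat.cast_pos.2 (totalRam_pos Q)
  obtain ⟨n, hn⟩ := (den_dvd_iff _ _).1 (den_dvd_totalRam Q hA)
  have hn0 : n ≠ 0 := by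
    rintro rfl
    exact (mul_pos a.2 hr).ne' (by simpa using hn)
  obtain ⟨j, rfl⟩ := Nat.exists_eq_succ_of_ne_zero hn0
  have hj : monomialExponent Q j = a := by
    apply Subtype.ext
    simp only [monomialExponent]
    rw [div_eq_iff hr.ne', hn]
    push_cast
    rfl
  exact ⟨⟨j, (lt_numCoeffs_iff Q j).2 (hj ▸ hK)⟩, hj⟩

theorem ofCoeffs_monomialExponent (x : Fin m → Fin (numCoeffs Q) → ℂ) (i : Fin m)
    (j : Fin (numCoeffs Q)) : (ofCoeffs Q x i).2 (monomialExponent Q j) = x i j := by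
  simp only [ofCoeffs, Finsupp.finsetSum_apply]
  rw [Finset.sum_eq_single j]
  · rw [Finsupp.single_eq_same]
  · intro k _ hk
    rw [Finsupp.single_apply, if_neg]
    exact fun h => hk (Fin.ext (monomialExponent_injective Q h))
  · simp

theorem ofCoeffs_eq_zero (x : Fin m → Fin (numCoeffs Q) → ℂ) (i : Fin m) {a : Expo}
    (ha : ∀ j : Fin (numCoeffs Q), monomialExponent Q j ≠ a) : (ofCoeffs Q x i).2 a = 0 := by
  simp only [ofCoeffs, Finsupp.finsetSum_apply]
  exact Finset.sum_eq_zero fun j _ => by rw [Finsupp.single_apply, if_neg (ha j)]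

theorem le_katz_of_ne_zero {i : Fin m} {a : Expo} (h : (Q i).2 a ≠ 0) : (a : ℚ≥0) ≤ katz Q := by
  by_contra hK
  refine h ((slope_lt_iff _ _).1 (lt_of_le_of_lt ?_ (not_le.1 hK)) a le_rfl)
  exact Finset.le_sup (f := fun i => slope (Q i).2) (Finset.mem_univ i)

theorem configSpace_nonempty : (configSpace Q).Nonempty := by
  refine ⟨fun i j => (Q i).2 (monomialExponent Q j), ?_⟩
  have : ofCoeffs Q (fun i j => (Q i).2 (monomialExponent Q j)) = Q := by
    funext i
    refine Prod.ext rfl ?_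
    ext a
    by_cases h : ∃ j : Fin (numCoeffs Q), monomialExponent Q j = a
    · obtain ⟨j, rfl⟩ := h
      rw [ofCoeffs_monomialExponent]
    · rw [ofCoeffs_eq_zero Q _ _ (fun j hj => h ⟨j, hj⟩)]
      by_contra h0
      exact h (exists_monomialExponent_eq Q (mem_exponents_of_ne_zero Q (Ne.symm h0))
        (le_katz_of_ne_zero Q (Ne.symm h0)))
  rw [configSpace, Set.mem_ofPred_eq, this]
  exact ⟨fun _ => rfl, fun _ _ _ _ _ _ => rfl⟩

/-! ### The global configuration space on the admissible vertices -/

/-- The maps on the admissible vertices of height at most the Poincaré–Katz rank whose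
restrictions to the sets of admissible children are local configurations. -/
def globalConfig : Set (boundedAdmissibleVertices Q → ℂ) :=
  {b | ∀ v, ∀ hv : v ∈ truncatedVertices Q,
    (fun u : (fissionDatum Q).admissibleChildren v =>
      b ⟨u, admissibleChildren_subset Q hv u.2⟩) ∈ (fissionDatum Q).localConfig v}

variable {Q} in
theorem localConfig_apply_congr (c : (v : truncatedVertices Q) → (fissionDatum Q).localConfig v)
    {v v' : truncatedVertices Q} (e : v = v') {u : (fissionDatum Q).Tree}
    (h : u ∈ (fissionDatum Q).admissibleChildren v)
    (h' : u ∈ (fissionDatum Q).admissibleChildren v') :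
    (c v).1 ⟨u, h⟩ = (c v').1 ⟨u, h'⟩ := by
  subst e
  rfl

/-- The global configurations decompose as families of local configurations. -/
noncomputable def globalConfigHomeomorph :
    globalConfig Q ≃ₜ ((v : truncatedVertices Q) → (fissionDatum Q).localConfig v) where
  toFun b v := ⟨fun u => b.1 ⟨u, admissibleChildren_subset Q v.2 u.2⟩, b.2 v v.2⟩
  invFun c := ⟨fun u => (c ⟨(exists_parent Q u.2).choose, (exists_parent Q u.2).choose_spec.1⟩).1
      ⟨u, (exists_parent Q u.2).choose_spec.2⟩, by
    intro v hv
    convert (c ⟨v, hv⟩).2 using 1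
    funext u
    exact localConfig_apply_congr c
      (Subtype.ext (parent_unique Q (exists_parent Q
        (admissibleChildren_subset Q hv u.2)).choose_spec.2 u.2)) _ u.2⟩
  left_inv b := rfl
  right_inv c := by
    funext v
    refine Subtype.ext (funext fun u => ?_)
    exact localConfig_apply_congr c
      (Subtype.ext (parent_unique Q (exists_parent Q
        (admissibleChildren_subset Q v.2 u.2)).choose_spec.2 u.2)) _ u.2
  continuous_toFun := by
    refine continuous_pi fun v => Continuous.subtype_mk (continuous_pi fun u => ?_) _
    exact (continuous_apply _).comp continuous_subtype_val
  continuous_invFun := by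
    refine Continuous.subtype_mk (continuous_pi fun u => ?_) _
    exact (continuous_apply _).comp (continuous_subtype_val.comp (continuous_apply _))

theorem mem_globalConfig_iff (b : boundedAdmissibleVertices Q → ℂ) :
    b ∈ globalConfig Q ↔
      (∀ u : boundedAdmissibleVertices Q, (u : (fissionDatum Q).Tree) ∈
        (fissionDatum Q).mandatoryVertices → b u ≠ 0) ∧
      ∀ u w : boundedAdmissibleVertices Q, ∀ v : (fissionDatum Q).Tree,
        (u : (fissionDatum Q).Tree) ∈ (fissionDatum Q).admissibleChildren v →
        (w : (fissionDatum Q).Tree) ∈ (fissionDatum Q).admissibleChildren v → u ≠ w →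
        b u ^ (fissionDatum Q).relRam v u ≠ b w ^ (fissionDatum Q).relRam v u := by
  constructor
  · intro h
    refine ⟨fun u hu => ?_, fun u w v hu hw huw => ?_⟩
    · obtain ⟨v, hv, huv⟩ := exists_parent Q u.2
      exact (h v hv).1 ⟨u, huv⟩ hu
    · obtain ⟨v', hv', huv⟩ := exists_parent Q u.2
      obtain rfl := parent_unique Q huv hu
      exact (h _ hv').2 ⟨u, hu⟩ ⟨w, hw⟩ fun h => huw (Subtype.ext (Subtype.mk.inj h))
  · rintro ⟨h1, h2⟩ v hv
    refine ⟨fun u hu => h1 _ hu, fun u w huw => h2 ⟨u, _⟩ ⟨w, _⟩ v u.2 w.2 fun h => huw ?_⟩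
    exact Subtype.ext (Subtype.mk.inj h)

/-! ### The parametrization of the configuration space -/

theorem mem_bounded {i : Fin m} {a : Expo} (h : (a : ℚ≥0).den ∣ denLcm (Q i).2 a)
    (hK : (a : ℚ≥0) ≤ katz Q) :
    (fissionDatum Q).point i ((a : ℚ≥0) : ℝ≥0) ∈ boundedAdmissibleVertices Q :=
  ⟨(point_mem_admissibleVertices_iff Q i a).2 h, by
    rw [height_point]
    exact NNRat.cast_le.2 hK⟩

theorem exists_index (v : boundedAdmissibleVertices Q) : ∃ i, ∃ j : Fin (numCoeffs Q),
    ((monomialExponent Q j : Expo) : ℚ≥0).den ∣ denLcm (Q i).2 (monomialExponent Q j) ∧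
    (v : (fissionDatum Q).Tree) =
      (fissionDatum Q).point i (((monomialExponent Q j : Expo) : ℚ≥0) : ℝ≥0) := by
  obtain ⟨v, ⟨i, a, ha, rfl⟩, hK⟩ := v
  rw [height_point, NNRat.cast_le] at hK
  obtain ⟨j, hj⟩ := exists_monomialExponent_eq Q (a := ⟨a, ha.1⟩) ⟨i, ha⟩ hK
  refine ⟨i, j, ?_, ?_⟩
  · rw [hj]
    exact (mem_admissibleExponents_iff _ ⟨a, ha.1⟩).1 ha
  · rw [hj]

open Classical in
/-- The principal parts with the given coefficients at the admissible vertices, up to the shifts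
`c` along the Galois orbits. -/
noncomputable def assemble (c : Fin m → ℤ) :
    (boundedAdmissibleVertices Q → ℂ) →ₗ[ℂ] (Fin m → Fin (numCoeffs Q) → ℂ) where
  toFun b i j := if h : ((monomialExponent Q j : Expo) : ℚ≥0).den ∣
      denLcm (Q i).2 (monomialExponent Q j) then
    chi (monomialExponent Q j) ^ (-c i) * b ⟨_, mem_bounded Q h ((lt_numCoeffs_iff Q j).1 j.2)⟩
    else 0
  map_add' b b' := by
    funext i j
    simp only [Pi.add_apply]
    split_ifs
    · rw [mul_add]
    · rw [add_zero]
  map_smul' z b := by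
    funext i j
    simp only [Pi.smul_apply, smul_eq_mul, RingHom.id_apply]
    split_ifs
    · ring
    · rw [mul_zero]

/-- The coefficients at the admissible vertices, up to the shifts `c` along the Galois orbits. -/
noncomputable def extract (c : Fin m → ℤ) :
    (Fin m → Fin (numCoeffs Q) → ℂ) →ₗ[ℂ] (boundedAdmissibleVertices Q → ℂ) where
  toFun x v := chi (monomialExponent Q (exists_index Q v).choose_spec.choose) ^
    c (exists_index Q v).choose * x (exists_index Q v).choose (exists_index Q v).choose_spec.choose
  map_add' x x' := by
    funext v
    simp only [Pi.add_apply]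
    rw [mul_add]
  map_smul' z b := by
    funext v
    simp only [Pi.smul_apply, smul_eq_mul, RingHom.id_apply]
    ring

theorem extract_assemble (c : Fin m → ℤ) (b : boundedAdmissibleVertices Q → ℂ) :
    extract Q c (assemble Q c b) = b := by
  funext v
  have h := (exists_index Q v).choose_spec.choose_spec
  simp only [extract, assemble, LinearMap.coe_mk, AddHom.coe_mk]
  rw [dif_pos h.1, ← mul_assoc, ← zpow_add₀ (chi_ne_zero _), add_neg_cancel, zpow_zero, one_mul]
  congr 1
  exact Subtype.ext h.2.symm

variable {Q} in
theorem compatible_iff {c : Fin m → ℤ}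
    (hc : ∀ i j, ∀ t : Expo, fissionExponent (Q i).2 (Q j).2 < t →
      Agree t (gal (c i) (Q i).2) (gal (c j) (Q j).2)) (i j : Fin m) (t : Expo) :
    Agree t (gal (c i) (Q i).2) (gal (c j) (Q j).2) ↔ fissionExponent (Q i).2 (Q j).2 < t :=
  ⟨fun h => (fissionExponent_lt_iff _ _ _).2 ⟨_, (agree_gal_iff _ _ _ _ _).1 h⟩, hc i j t⟩

variable {Q} in
theorem mem_configSpace_iff {c : Fin m → ℤ}
    (hc : ∀ i j, ∀ t : Expo, fissionExponent (Q i).2 (Q j).2 < t →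
      Agree t (gal (c i) (Q i).2) (gal (c j) (Q j).2)) (x : Fin m → Fin (numCoeffs Q) → ℂ) :
    x ∈ configSpace Q ↔
      CoeffConditions (fun i => gal (c i) (Q i).2) (fun i => gal (c i) (ofCoeffs Q x i).2) := by
  have hcomp : IsCompatible (fun i => gal (c i) (Q i).2) := by
    rintro i j t ⟨n, hn⟩
    rw [gal_gal, agree_gal_iff] at hn
    exact hc i j t ((fissionExponent_lt_iff _ _ _).2 ⟨_, hn⟩)
  rw [coeffConditions_iff hcomp, configSpace, Set.mem_ofPred_eq,
    numEquiv_iff (Q' := ofCoeffs Q x) (Q := Q) fun _ => rfl]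
  simp only [gal_gal, agree_gal_iff]
  refine ⟨fun h i j t n => h i j t _, fun h i j t n => ?_⟩
  have := h i j t (n + c i - c j)
  rwa [sub_add_cancel, add_sub_cancel_right] at this

variable {Q} in
theorem agreeAbove_of_isNext {c : Fin m → ℤ}
    (hc : ∀ i j, ∀ t : Expo, fissionExponent (Q i).2 (Q j).2 < t →
      Agree t (gal (c i) (Q i).2) (gal (c j) (Q j).2)) {i j : Fin m} {a g : Expo}
    (hg : IsNext Q a g) (h : fissionExponent (Q i).2 (Q j).2 < g) :
    AgreeAbove a (gal (c i) (Q i).2) (gal (c j) (Q j).2) := by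
  intro k hk
  by_cases hgk : g ≤ k
  · exact hc i j g h k hgk
  · have h0 : ∀ i, (Q i).2 k = 0 := by
      intro i
      by_contra h0
      exact hgk (hg.le (mem_exponents_of_ne_zero Q h0) hk)
    rw [gal_apply, gal_apply, h0, h0, mul_zero, mul_zero]

theorem relRam_eq {i : Fin m} {a g : Expo} (hg : IsNext Q a g) :
    (fissionDatum Q).relRam ((fissionDatum Q).point i ((g : ℚ≥0) : ℝ≥0))
      ((fissionDatum Q).point i ((a : ℚ≥0) : ℝ≥0)) =
      denLcm (Q i).2 a / denLcmAbove (Q i).2 a := by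
  rw [FissionDatum.relRam, ramIndex_point, ramIndex_point, denLcmAbove_eq_denLcm Q hg]

theorem gal_assemble (c : Fin m → ℤ) (b : boundedAdmissibleVertices Q → ℂ) (i : Fin m) {a : Expo}
    (h : (a : ℚ≥0).den ∣ denLcm (Q i).2 a) (hK : (a : ℚ≥0) ≤ katz Q) :
    gal (c i) (ofCoeffs Q (assemble Q c b) i).2 a = b ⟨_, mem_bounded Q h hK⟩ := by
  obtain ⟨j, rfl⟩ := exists_monomialExponent_eq Q (mem_exponents_of_den_dvd Q h) hK
  rw [gal_apply, ofCoeffs_monomialExponent]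
  simp only [assemble, LinearMap.coe_mk, AddHom.coe_mk]
  rw [dif_pos h, ← mul_assoc, ← zpow_add₀ (chi_ne_zero _), add_neg_cancel, zpow_zero, one_mul]

theorem gal_assemble_ne_zero (c : Fin m → ℤ) (b : boundedAdmissibleVertices Q → ℂ) (i : Fin m)
    {a : Expo} (h0 : gal (c i) (ofCoeffs Q (assemble Q c b) i).2 a ≠ 0) :
    (a : ℚ≥0).den ∣ denLcm (Q i).2 a ∧ (a : ℚ≥0) ≤ katz Q := by
  rw [gal_ne_zero_iff] at h0
  by_cases h : ∃ j : Fin (numCoeffs Q), monomialExponent Q j = a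
  · obtain ⟨j, rfl⟩ := h
    refine ⟨?_, (lt_numCoeffs_iff Q j).1 j.2⟩
    by_contra hd
    rw [ofCoeffs_monomialExponent] at h0
    simp only [assemble, LinearMap.coe_mk, AddHom.coe_mk] at h0
    exact h0 (dif_neg hd)
  · exact absurd (ofCoeffs_eq_zero Q _ _ fun j hj => h ⟨j, hj⟩) h0

theorem configSpace_eq_image {c : Fin m → ℤ}
    (hc : ∀ i j, ∀ t : Expo, fissionExponent (Q i).2 (Q j).2 < t →
      Agree t (gal (c i) (Q i).2) (gal (c j) (Q j).2)) :
    configSpace Q = assemble Q c '' globalConfig Q := by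
  ext x
  rw [mem_configSpace_iff hc]
  constructor
  · intro h
    have hb : ∀ (i : Fin m) (a : Expo)
        (hv : (fissionDatum Q).point i ((a : ℚ≥0) : ℝ≥0) ∈ boundedAdmissibleVertices Q),
        extract Q c x ⟨_, hv⟩ = gal (c i) (ofCoeffs Q x i).2 a := by
      intro i a hv
      have hs := (exists_index Q ⟨_, hv⟩).choose_spec.choose_spec
      simp only [extract, LinearMap.coe_mk, AddHom.coe_mk]
      generalize (exists_index Q ⟨_, hv⟩).choose_spec.choose = j at hs ⊢
      generalize (exists_index Q ⟨_, hv⟩).choose = i' at hs ⊢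
      have ha : a = monomialExponent Q j :=
        Subtype.ext (NNRat.cast_injective ((point_eq_iff _ _ _ _ _).1 hs.2).1)
      have hf := lt_of_point_eq Q hs.2
      rw [← ofCoeffs_monomialExponent Q x i' j, ← gal_apply, ← ha]
      exact (h.glue i i' a (hc _ _ _ hf)).symm
    refine ⟨extract Q c x, ?_, ?_⟩
    · rw [mem_globalConfig_iff]
      refine ⟨?_, ?_⟩
      · rintro ⟨_, hv⟩ hu
        obtain ⟨i, a, ha, rfl⟩ := id hu
        rw [hb i ⟨a, ha.1⟩]
        exact h.mandatory i ⟨a, ha.1⟩ ((levels_gal _ _ ⟨a, ha.1⟩).2 ha)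
      · rintro ⟨u, hu⟩ ⟨w, hw⟩ v hvu hvw huw
        obtain ⟨i, a, g, ha, hg, rfl, rfl⟩ := (mem_admissibleChildren_iff Q _ _).1 hvu
        obtain ⟨j, a', g', ha', hg', rfl, hv⟩ := (mem_admissibleChildren_iff Q _ _).1 hvw
        obtain rfl : g = g' :=
          Subtype.ext (NNRat.cast_injective ((point_eq_iff _ _ _ _ _).1 hv).1)
        obtain rfl : a = a' := Subtype.ext
          (hg.unique_left hg' (Or.inr (mem_exponents_of_den_dvd Q ha))
            (Or.inr (mem_exponents_of_den_dvd Q ha')))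
        rw [hb, hb, relRam_eq Q hg]
        have := h.separate i j a (agreeAbove_of_isNext hc hg (lt_of_point_eq Q hv)) ?_ ?_ ?_
        · simpa only [denLcm_gal, denLcmAbove_gal] using this
        · rw [compatible_iff hc]
          exact fun hf => huw (Subtype.ext
            ((point_eq_iff_of_mem Q i j a (mem_exponents_of_den_dvd Q ha)).2 hf))
        · rwa [denLcm_gal]
        · rwa [denLcm_gal]
    · funext i j
      simp only [assemble, LinearMap.coe_mk, AddHom.coe_mk]
      split_ifs with hd
      · rw [hb, gal_apply, ← mul_assoc, ← zpow_add₀ (chi_ne_zero _), neg_add_cancel, zpow_zero,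
          one_mul, ofCoeffs_monomialExponent]
      · by_contra h0
        have := h.admissible i (monomialExponent Q j) ((gal_ne_zero_iff _ _ _).2 (by
          rw [ofCoeffs_monomialExponent]; exact Ne.symm h0))
        rw [denLcm_gal] at this
        exact hd this
  · rintro ⟨b, hb, rfl⟩
    rw [mem_globalConfig_iff] at hb
    constructor
    · intro i a h0
      rw [denLcm_gal]
      exact (gal_assemble_ne_zero Q c b i h0).1
    · intro i a ha
      rw [levels_gal] at ha
      have h0 := ((mem_levels_iff _ _).1 ha).1
      rw [gal_assemble Q c b i (den_dvd_denLcm le_rfl h0) (le_katz_of_ne_zero Q h0)]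
      exact hb.1 _ ((point_mem_mandatoryVertices_iff Q i a).2 ha)
    · intro i j a hA
      rw [compatible_iff hc] at hA
      by_cases h : (a : ℚ≥0).den ∣ denLcm (Q i).2 a ∧ (a : ℚ≥0) ≤ katz Q
      · rw [gal_assemble Q c b i h.1 h.2,
          gal_assemble Q c b j (by rw [← denLcm_eq_of_lt hA]; exact h.1) h.2]
        congr 1
        exact Subtype.ext
          ((point_eq_iff_of_mem Q i j a (mem_exponents_of_den_dvd Q h.1)).2 hA)
      · have hi : gal (c i) (ofCoeffs Q (assemble Q c b) i).2 a = 0 := by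
          by_contra h0
          exact h (gal_assemble_ne_zero Q c b i h0)
        have hj : gal (c j) (ofCoeffs Q (assemble Q c b) j).2 a = 0 := by
          by_contra h0
          refine h ?_
          rw [denLcm_eq_of_lt hA]
          exact gal_assemble_ne_zero Q c b j h0
        exact hi.trans hj.symm
    · intro i j a hab hnot hi hj
      rw [denLcm_gal] at hi hj
      rw [denLcm_gal, denLcmAbove_gal]
      have hK : (a : ℚ≥0) ≤ katz Q := by
        by_contra hK
        refine hnot (agree_iff_above.2 ⟨hab, ?_⟩)
        have h0 : ∀ i, (Q i).2 a = 0 := fun i => by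
          by_contra h0
          exact hK (le_katz_of_ne_zero Q h0)
        rw [gal_apply, gal_apply, h0, h0, mul_zero, mul_zero]
      obtain ⟨g, hg⟩ := exists_isNext Q i a
      have hgpos : 0 < g := (zero_le).trans_lt hg.lt
      have hfg : fissionExponent (Q i).2 (Q j).2 < (⟨g, hgpos⟩ : Expo) :=
        (compatible_iff hc i j _).1 (agreeAbove_iff.1 hab ⟨g, hgpos⟩ hg.lt)
      rw [compatible_iff hc] at hnot
      rw [gal_assemble Q c b i hi hK, gal_assemble Q c b j hj hK, ← relRam_eq Q (g := ⟨g, hgpos⟩) hg]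
      refine hb.2 ⟨_, _⟩ ⟨_, _⟩ _ ?_ ?_ ?_
      · exact (mem_admissibleChildren_iff Q _ _).2 ⟨i, a, ⟨g, hgpos⟩, hi, hg, rfl, rfl⟩
      · exact (mem_admissibleChildren_iff Q _ _).2 ⟨j, a, ⟨g, hgpos⟩, hj, hg, rfl,
          (point_eq_iff_of_mem Q i j ⟨g, hgpos⟩ hg.mem).2 hfg⟩
      · intro h
        exact hnot ((point_eq_iff_of_mem Q i j a (mem_exponents_of_den_dvd Q hi)).1
          (congrArg Subtype.val h))

end Coefficients

end Fission

/-! ### Complements of hypersurfaces -/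

theorem MvPolynomial.isOpen_setOf_eval_ne_zero {V ι : Type*} [Finite ι]
    (P : ι → MvPolynomial V ℂ) : IsOpen {b : V → ℂ | ∀ k, MvPolynomial.eval b (P k) ≠ 0} := by
  have : {b : V → ℂ | ∀ k, MvPolynomial.eval b (P k) ≠ 0} =
      ⋂ k, {b | MvPolynomial.eval b (P k) ≠ 0} := by
    ext b
    simp
  rw [this]
  exact isOpen_iInter_of_finite fun k =>
    isOpen_ne_fun (MvPolynomial.continuous_eval (P k)) continuous_const

theorem MvPolynomial.isPreconnected_setOf_eval_ne_zero {V ι : Type*} [Finite ι]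
    (P : ι → MvPolynomial V ℂ) :
    IsPreconnected {b : V → ℂ | ∀ k, MvPolynomial.eval b (P k) ≠ 0} := by
  refine isPreconnected_of_forall_pair fun x hx y hy => ?_
  let p : ι → Polynomial ℂ := fun k => MvPolynomial.aeval
    (fun v => Polynomial.C (x v) + Polynomial.X * Polynomial.C (y v - x v)) (P k)
  have hp : ∀ k (z : ℂ), (p k).eval z = MvPolynomial.eval (fun v => x v + z * (y v - x v)) (P k) := by
    intro k z
    have h := MvPolynomial.map_aeval (fun v => Polynomial.C (x v) +
      Polynomial.X * Polynomial.C (y v - x v)) (Polynomial.evalRingHom z) (P k)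
    have h2 : (p k).eval z = Polynomial.evalRingHom z (p k) := rfl
    rw [h2, h, MvPolynomial.eval, MvPolynomial.coe_eval₂Hom, MvPolynomial.coe_eval₂Hom]
    congr 1
    · ext
      simp
    · funext v
      simp
  have h0 : ∀ v, x v + (0 : ℂ) * (y v - x v) = x v := fun v => by ring
  have h1 : ∀ v, x v + (1 : ℂ) * (y v - x v) = y v := fun v => by ring
  have hp0 : ∀ k, p k ≠ 0 := by
    intro k hk
    have := hp k 0
    simp only [h0] at this
    rw [hk, Polynomial.eval_zero] at this
    exact hx k this.symm
  let Z : Set ℂ := {z | ∃ k, (p k).IsRoot z}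
  have hZ : Z.Finite := by
    have : Z = ⋃ k, {z | (p k).IsRoot z} := by
      ext z
      simp [Z]
    rw [this]
    exact Set.finite_iUnion fun k => Polynomial.finite_setOfPred_isRoot (hp0 k)
  have hconn : IsPreconnected Zᶜ :=
    (hZ.countable.isPathConnected_compl_of_one_lt_rank
      (by rw [Complex.rank_real_complex]; exact Cardinal.one_lt_two)).isConnected.isPreconnected
  have hcont : Continuous fun z : ℂ => (fun v => x v + z * (y v - x v)) :=
    continuous_pi fun v => by fun_prop
  refine ⟨(fun z : ℂ => (fun v => x v + z * (y v - x v))) '' Zᶜ, ?_, ⟨0, ?_, ?_⟩, ⟨1, ?_, ?_⟩,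
    hconn.image _ hcont.continuousOn⟩
  · rintro _ ⟨z, hz, rfl⟩ k hk
    exact hz ⟨k, (hp k z).trans hk⟩
  · rintro ⟨k, hk⟩
    refine hx k ?_
    rw [Polynomial.IsRoot, hp] at hk
    simpa only [h0] using hk
  · exact _root_.funext h0
  · rintro ⟨k, hk⟩
    refine hy k ?_
    rw [Polynomial.IsRoot, hp] at hk
    simpa only [h1] using hk
  · exact _root_.funext h1

namespace Fission

/-! ### Linearly parametrized subsets -/

/-- A linear embedding with a linear left inverse restricts to a homeomorphism onto the image. -/
noncomputable def imageHomeomorph {E F : Type*} [NormedAddCommGroup E] [NormedSpace ℂ E]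
    [FiniteDimensional ℂ E] [NormedAddCommGroup F] [NormedSpace ℂ F] [FiniteDimensional ℂ F]
    (f : F →ₗ[ℂ] E) (g : E →ₗ[ℂ] F) (h : ∀ b, g (f b) = b) (C : Set F) : C ≃ₜ f '' C where
  toFun b := ⟨f b, b, b.2, rfl⟩
  invFun x := ⟨g x, by
    obtain ⟨_, b, hb, rfl⟩ := x
    rwa [h]⟩
  left_inv b := Subtype.ext (h b)
  right_inv x := by
    obtain ⟨_, b, hb, rfl⟩ := x
    exact Subtype.ext (congrArg f (h b))
  continuous_toFun :=
    (f.continuous_of_finiteDimensional.comp continuous_subtype_val).subtype_mk _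
  continuous_invFun :=
    (g.continuous_of_finiteDimensional.comp continuous_subtype_val).subtype_mk _

theorem hasComplexDim_image {E F : Type*} [NormedAddCommGroup E] [NormedSpace ℂ E]
    [FiniteDimensional ℂ E] [NormedAddCommGroup F] [NormedSpace ℂ F] [FiniteDimensional ℂ F]
    (f : F →ₗ[ℂ] E) (g : E →ₗ[ℂ] F) (h : ∀ b, g (f b) = b) {C : Set F} (hC : IsOpen C)
    (hne : C.Nonempty) : HasComplexDim (f '' C) (Module.finrank ℂ F) := by
  refine ⟨hne.image _, fun p hp => ⟨g ⁻¹' C, hC.preimage g.continuous_of_finiteDimensional, ?_, ?_⟩⟩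
  · obtain ⟨b, hb, rfl⟩ := hp
    rwa [Set.mem_preimage, h]
  · let e : (E ⧸ LinearMap.range f) ≃ₗ[ℂ] (Fin (Module.finrank ℂ (E ⧸ LinearMap.range f)) → ℂ) :=
      (Module.finBasis ℂ (E ⧸ LinearMap.range f)).equivFun
    let φ : E →ₗ[ℂ] (Fin (Module.finrank ℂ (E ⧸ LinearMap.range f)) → ℂ) :=
      e.toLinearMap ∘ₗ (LinearMap.range f).mkQ
    have hφ : Function.Surjective φ := e.surjective.comp (Submodule.mkQ_surjective _)
    have hφ0 : ∀ x, φ x = 0 ↔ x ∈ LinearMap.range f := by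
      intro x
      rw [LinearMap.comp_apply, LinearEquiv.coe_coe, LinearEquiv.map_eq_zero_iff,
        Submodule.mkQ_apply, Submodule.Quotient.mk_eq_zero]
    refine ⟨_, φ, ?_, ?_, ?_, ?_⟩
    · rw [← Submodule.finrank_quotient_add_finrank (LinearMap.range f),
        LinearMap.finrank_range_of_inj (Function.LeftInverse.injective h)]
    · exact (LinearMap.toContinuousLinearMap φ).differentiable.differentiableOn
    · intro x _
      have : fderiv ℂ φ x = LinearMap.toContinuousLinearMap φ :=
        (LinearMap.toContinuousLinearMap φ).fderiv
      rw [this]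
      exact hφ
    · ext x
      constructor
      · rintro ⟨⟨b, hb, rfl⟩, hx⟩
        exact ⟨hx, (hφ0 _).2 ⟨b, rfl⟩⟩
      · rintro ⟨hx, h0⟩
        obtain ⟨b, rfl⟩ := (hφ0 x).1 h0
        refine ⟨⟨b, ?_, rfl⟩, hx⟩
        rwa [Set.mem_preimage, h] at hx

section Main

variable {m : ℕ} (Q : Fin m → ℕ × PuiseuxPart)

open Classical in
theorem exists_globalConfig_eq :
    ∃ (P : boundedAdmissibleVertices Q ⊕
        (boundedAdmissibleVertices Q × boundedAdmissibleVertices Q) →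
        MvPolynomial (boundedAdmissibleVertices Q) ℂ),
      globalConfig Q = {b | ∀ k, MvPolynomial.eval b (P k) ≠ 0} := by
  let P : boundedAdmissibleVertices Q ⊕
        (boundedAdmissibleVertices Q × boundedAdmissibleVertices Q) →
        MvPolynomial (boundedAdmissibleVertices Q) ℂ :=
    Sum.elim
      (fun u => if (u : (fissionDatum Q).Tree) ∈ (fissionDatum Q).mandatoryVertices
        then MvPolynomial.X u else 1)
      (fun x => if h : x.1 ≠ x.2 ∧ ∃ v, (x.1 : (fissionDatum Q).Tree) ∈
          (fissionDatum Q).admissibleChildren v ∧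
          (x.2 : (fissionDatum Q).Tree) ∈ (fissionDatum Q).admissibleChildren v
        then MvPolynomial.X x.1 ^ (fissionDatum Q).relRam h.2.choose x.1 -
          MvPolynomial.X x.2 ^ (fissionDatum Q).relRam h.2.choose x.1
        else 1)
  refine ⟨P, ?_⟩
  ext b
  rw [mem_globalConfig_iff, Set.mem_ofPred_eq, Sum.forall]
  refine and_congr (forall_congr' fun u => ?_) ?_
  · simp only [P, Sum.elim_inl]
    split_ifs with h <;> simp [h]
  · rw [Prod.forall]
    refine forall₂_congr fun u w => ?_
    simp only [P, Sum.elim_inr]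
    split_ifs with h
    · have hs := h.2.choose_spec
      generalize h.2.choose = v at hs ⊢
      simp only [map_sub, map_pow, MvPolynomial.eval_X, sub_ne_zero]
      refine ⟨fun h' => h' v hs.1 hs.2 h.1, fun h' v' hu _ _ => ?_⟩
      rw [parent_unique Q hu hs.1]
      exact h'
    · simp only [map_one, ne_eq, one_ne_zero, not_false_eq_true, iff_true]
      exact fun v hu hw huw => absurd ⟨huw, v, hu, hw⟩ h

theorem relRam_uniform {v u w : (fissionDatum Q).Tree}
    (hu : u ∈ (fissionDatum Q).admissibleChildren v)
    (hw : w ∈ (fissionDatum Q).admissibleChildren v) :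
    (fissionDatum Q).relRam v u = (fissionDatum Q).relRam v w := by
  rw [FissionDatum.relRam, FissionDatum.relRam, (admissibleChildren_uniform Q hu hw).2]

/-- Reindexing of a space of functions that is cut out by conditions. -/
noncomputable def reindexHomeomorph {ι κ : Type*} (e : κ ≃ ι) {A : Set (ι → ℂ)} {B : Set (κ → ℂ)}
    (h : ∀ c : ι → ℂ, c ∈ A ↔ c ∘ e ∈ B) : A ≃ₜ B where
  toFun c := ⟨c.1 ∘ e, (h c).1 c.2⟩
  invFun d := ⟨d.1 ∘ e.symm, (h _).2 (by
    rw [Function.comp_assoc, Equiv.symm_comp_self, Function.comp_id]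
    exact d.2)⟩
  left_inv c := Subtype.ext (by simp [Function.comp_assoc])
  right_inv d := Subtype.ext (by simp [Function.comp_assoc])
  continuous_toFun := by
    refine Continuous.subtype_mk (continuous_pi fun k => ?_) _
    exact (continuous_apply (e k)).comp continuous_subtype_val
  continuous_invFun := by
    refine Continuous.subtype_mk (continuous_pi fun k => ?_) _
    exact (continuous_apply (e.symm k)).comp continuous_subtype_val

theorem nonempty_localConfig_homeomorph_punit {v : (fissionDatum Q).Tree}
    (h : (fissionDatum Q).admissibleChildren v = ∅) :
    Nonempty ((fissionDatum Q).localConfig v ≃ₜ PUnit.{1}) := by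
  have : IsEmpty ((fissionDatum Q).admissibleChildren v) := Set.isEmpty_coe_sort.2 h
  have : Unique ((fissionDatum Q).localConfig v) :=
    { default := ⟨fun _ => 0, fun u => isEmptyElim u, fun u => isEmptyElim u⟩
      uniq := fun c => Subtype.ext (funext fun u => isEmptyElim u) }
  exact ⟨Homeomorph.homeomorphOfUnique _ _⟩

theorem nonempty_localConfig_homeomorph_configX {v : (fissionDatum Q).Tree}
    (hfin : ((fissionDatum Q).admissibleChildren v).Finite)
    (h : ∀ u ∈ (fissionDatum Q).admissibleChildren v, u ∉ (fissionDatum Q).mandatoryVertices) :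
    Nonempty ((fissionDatum Q).localConfig v ≃ₜ
      configX ((fissionDatum Q).admissibleChildren v).ncard) := by
  have : Finite ((fissionDatum Q).admissibleChildren v) := hfin.to_subtype
  let e : Fin ((fissionDatum Q).admissibleChildren v).ncard ≃
    (fissionDatum Q).admissibleChildren v := (Finite.equivFinOfCardEq rfl).symm
  have hN : ∀ u : (fissionDatum Q).admissibleChildren v, (fissionDatum Q).relRam v u = 1 := by
    intro u
    obtain ⟨hv, -, -, heq⟩ := ramIndex_dvd Q u.2
    rw [FissionDatum.relRam, heq (h u u.2), Nat.div_self hv]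
  refine ⟨reindexHomeomorph e fun c => ⟨fun hc i j hij => ?_, fun hc => ⟨fun u hu => ?_, ?_⟩⟩⟩
  · simpa [hN] using hc.2 (e i) (e j) (e.injective.ne hij)
  · exact absurd hu (h u u.2)
  · intro u w huw
    simpa [hN] using hc (e.symm u) (e.symm w) (e.symm.injective.ne huw)

theorem nonempty_localConfig_homeomorph_configXStar {v : (fissionDatum Q).Tree}
    (hfin : ((fissionDatum Q).admissibleChildren v).Finite)
    (h : ∀ u ∈ (fissionDatum Q).admissibleChildren v, u ∈ (fissionDatum Q).mandatoryVertices)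
    {N : ℕ} (hN : ∀ u ∈ (fissionDatum Q).admissibleChildren v, (fissionDatum Q).relRam v u = N) :
    Nonempty ((fissionDatum Q).localConfig v ≃ₜ
      configXStar ((fissionDatum Q).admissibleChildren v).ncard N) := by
  have : Finite ((fissionDatum Q).admissibleChildren v) := hfin.to_subtype
  let e : Fin ((fissionDatum Q).admissibleChildren v).ncard ≃
    (fissionDatum Q).admissibleChildren v := (Finite.equivFinOfCardEq rfl).symm
  refine ⟨reindexHomeomorph e fun c => ⟨fun hc => ⟨fun i => hc.1 _ (h _ (e i).2),
    fun i j hij => ?_⟩, fun hc => ⟨fun u _ => ?_, fun u w huw => ?_⟩⟩⟩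
  · have := hc.2 (e i) (e j) (e.injective.ne hij)
    rwa [hN _ (e i).2] at this
  · simpa using hc.1 (e.symm u)
  · rw [hN _ u.2]
    simpa using hc.2 (e.symm u) (e.symm w) (e.symm.injective.ne huw)

end Main

end Fission

open Fission
theorem mainTheorem3 {m : ℕ} (Q : Fin m → ℕ × PuiseuxPart) (hQ : IsPointedIrregularType Q) :
    -- the product decomposition
    Nonempty (configSpace Q ≃ₜ ((v : truncatedVertices Q) → (fissionDatum Q).localConfig v)) ∧
    -- the local factors
    (∀ v ∈ truncatedVertices Q,
      ((fissionDatum Q).admissibleChildren v = ∅ ∧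
        Nonempty ((fissionDatum Q).localConfig v ≃ₜ PUnit.{1})) ∨
      (((fissionDatum Q).admissibleChildren v).Nonempty ∧
        ((fissionDatum Q).admissibleChildren v).Finite ∧
        (fissionDatum Q).admissibleChildren v ⊆ (fissionDatum Q).inconsequentialVertices ∧
        Nonempty ((fissionDatum Q).localConfig v ≃ₜ
          configX ((fissionDatum Q).admissibleChildren v).ncard)) ∨
      (((fissionDatum Q).admissibleChildren v).Nonempty ∧
        ((fissionDatum Q).admissibleChildren v).Finite ∧
        (fissionDatum Q).admissibleChildren v ⊆ (fissionDatum Q).mandatoryVertices ∧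
        ∃ N : ℕ, 0 < N ∧
          (∀ u ∈ (fissionDatum Q).admissibleChildren v,
            (fissionDatum Q).ramIndex u = N * (fissionDatum Q).ramIndex v) ∧
          Nonempty ((fissionDatum Q).localConfig v ≃ₜ
            configXStar ((fissionDatum Q).admissibleChildren v).ncard N))) ∧
    -- the dimension
    (boundedAdmissibleVertices Q).Finite ∧
    HasComplexDim (configSpace Q) (boundedAdmissibleVertices Q).ncard ∧
    -- connectedness
    IsConnected (configSpace Q) := by
  obtain ⟨c, hc⟩ := exists_compatible_shifts (fun i => (Q i).2) Finset.univ
  replace hc : ∀ i j, ∀ t : Expo, fissionExponent (Q i).2 (Q j).2 < t →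
      Agree t (gal (c i) (Q i).2) (gal (c j) (Q j).2) := fun i j =>
    hc i (Finset.mem_univ i) j (Finset.mem_univ j)
  have hfin := boundedAdmissibleVertices_finite Q
  have : Fintype (boundedAdmissibleVertices Q) := hfin.fintype
  have himg := configSpace_eq_image Q hc
  have hne : (globalConfig Q).Nonempty := by
    rw [← Set.image_nonempty, ← himg]
    exact configSpace_nonempty Q
  obtain ⟨P, hP⟩ := exists_globalConfig_eq Q
  have hopen : IsOpen (globalConfig Q) := by
    rw [hP]
    exact MvPolynomial.isOpen_setOf_eval_ne_zero P
  have hpre : IsPreconnected (globalConfig Q) := by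
    rw [hP]
    exact MvPolynomial.isPreconnected_setOf_eval_ne_zero P
  refine ⟨?_, fun v hv => ?_, hfin, ?_, ?_⟩
  · exact ⟨(Homeomorph.setCongr himg).trans ((imageHomeomorph (assemble Q c) (extract Q c)
      (extract_assemble Q c) (globalConfig Q)).symm.trans (globalConfigHomeomorph Q))⟩
  · have hCh := hfin.subset (admissibleChildren_subset Q hv)
    rcases ((fissionDatum Q).admissibleChildren v).eq_empty_or_nonempty with hem | ⟨u, hu⟩
    · exact Or.inl ⟨hem, nonempty_localConfig_homeomorph_punit Q hem⟩
    · right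
      by_cases hman : u ∈ (fissionDatum Q).mandatoryVertices
      · right
        have hall : ∀ w ∈ (fissionDatum Q).admissibleChildren v,
            w ∈ (fissionDatum Q).mandatoryVertices := fun w hw =>
          (admissibleChildren_uniform Q hu hw).1.1 hman
        obtain ⟨hv0, hu0, hdvd, -⟩ := ramIndex_dvd Q hu
        refine ⟨⟨u, hu⟩, hCh, hall, (fissionDatum Q).relRam v u,
          Nat.div_pos (Nat.le_of_dvd hu0 hdvd) hv0, fun w hw => ?_,
          nonempty_localConfig_homeomorph_configXStar Q hCh hall fun w hw =>
            relRam_uniform Q hw hu⟩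
        rw [← relRam_uniform Q hw hu, FissionDatum.relRam,
          Nat.div_mul_cancel (ramIndex_dvd Q hw).2.2.1]
      · left
        have hall : ∀ w ∈ (fissionDatum Q).admissibleChildren v,
            w ∉ (fissionDatum Q).mandatoryVertices := fun w hw hw' =>
          hman ((admissibleChildren_uniform Q hu hw).1.2 hw')
        exact ⟨⟨u, hu⟩, hCh, fun w hw => ⟨hw.2, hall w hw⟩,
          nonempty_localConfig_homeomorph_configX Q hCh hall⟩
  · have hdim : (boundedAdmissibleVertices Q).ncard =
        Module.finrank ℂ (boundedAdmissibleVertices Q → ℂ) := by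
      rw [Module.finrank_fintype_fun_eq_card, ← Nat.card_coe_set_eq, Nat.card_eq_fintype_card]
    rw [hdim, himg]
    exact hasComplexDim_image (assemble Q c) (extract Q c) (extract_assemble Q c) hopen hne
  · rw [himg]
    exact ⟨hne.image _, hpre.image _
      (assemble Q c).continuous_of_finiteDimensional.continuousOn⟩
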